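/- Let $n \ge 2$, let $G = SL(n,\mathbb{C})$, $K = SU(n)$, and let $Z = G/K$ be the associated symmetric space, with base point $u$ (the class of $1$). Endow $Z$ with the $G$-invariant Riemannian metric given on $T_uZ \cong \mathfrak{p} = \{X \in \mathfrak{sl}(n,\mathbb{C}) : X^* = X\}$ by the Killing form $B(X,Y) = 4n\,\mathrm{Re}\,\mathrm{Tr}(XY)$, and let $\mathrm{dist}$ be the corresponding distance. A ray is a unit speed half-geodesic $\gamma : \mathbb{R}_{\ge 0} \to Z$. Two rays $\gamma_1, \gamma_2$ are asymptotic if $\mathrm{dist}(\gamma_1(t), \gamma_2(t))$ is bounded in $t \ge 0$. Let $Z(\infty)$ be the set of asymptoticity classes of rays, with the action of $G$ induced by the action of $G$ on $Z$ by isometries. Let $W$ and $W'$ be subspaces of $\mathbb{C}^n$, both different from $0$ and $\mathbb{C}^n$. Then there is a unique point $z_W \in Z(\infty)$ whose stabilizer in $G$ is $\{g \in G : gW = W\}$, and a unique point $z_{W'} \in Z(\infty)$ whose stabilizer in $G$ is $\{g \in G : gW' = W'\}$. Moreover, there exists a unit speed geodesic $\gamma : \mathbb{R} \to Z$ such that the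 rays $t \mapsto \gamma(t)$ and $t \mapsto \gamma(-t)$ $(t \ge 0)$ belong to the classes $z_W$ and $z_{W'}$, respectively, if and only if $\mathbb{C}^n = W \oplus W'$ (internal direct sum). -/

import Mathlib

open scoped NNReal ENNReal Topology Matrix

namespace SymSpace

variable {n : ℕ}

/-- The group `G = SL(n, ℂ)`. -/
abbrev G (n : ℕ) : Type := Matrix.SpecialLinearGroup (Fin n) ℂ

/-- The maximal compact subgroup `K = SU(n)` of `SL(n, ℂ)`. -/
def K (n : ℕ) : Subgroup (G n) where
  carrier := {g | (g : Matrix (Fin n) (Fin n) ℂ) ∈ Matrix.unitaryGroup (Fin n) ℂ}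
  mul_mem' := by
    intro a b ha hb
    simpa using mul_mem ha hb
  one_mem' := by simp [one_mem]
  inv_mem' := by
    intro a ha
    have h1 : (a : Matrix (Fin n) (Fin n) ℂ) * star (a : Matrix (Fin n) (Fin n) ℂ) = 1 :=
      Matrix.mem_unitaryGroup_iff.1 ha
    have h2 : ((a⁻¹ : G n) : Matrix (Fin n) (Fin n) ℂ) * (a : Matrix (Fin n) (Fin n) ℂ) = 1 := by
      rw [← Matrix.SpecialLinearGroup.coe_mul, inv_mul_cancel, Matrix.SpecialLinearGroup.coe_one]
    have h3 : ((a⁻¹ : G n) : Matrix (Fin n) (Fin n) ℂ) = star (a : Matrix (Fin n) (Fin n) ℂ) :=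
      left_inv_eq_right_inv h2 h1
    change ((a⁻¹ : G n) : Matrix (Fin n) (Fin n) ℂ) ∈ Matrix.unitaryGroup (Fin n) ℂ
    rw [h3]
    exact Unitary.star_mem ha

/-- The symmetric space `Z = G / K`, with the left action of `G`. -/
abbrev Z (n : ℕ) : Type := G n ⧸ K n

/-- The Killing form `B(X, Y) = 4 n Re Tr (X Y)` of the real Lie algebra `sl(n, ℂ)`. -/
def killing (X Y : Matrix (Fin n) (Fin n) ℂ) : ℝ := 4 * n * (X * Y).trace.re

/-- The component in `p = {X | Xᴴ = X}` of a matrix, for `sl(n, ℂ) = p + k` with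
`k = {X | Xᴴ = -X}`. -/
noncomputable def pPart (A : Matrix (Fin n) (Fin n) ℂ) : Matrix (Fin n) (Fin n) ℂ :=
  (1 / 2 : ℂ) • (A + Aᴴ)

/-- The curve `c` in `SL(n, ℂ)` is continuously differentiable. -/
def IsC1 (c : ℝ → G n) : Prop :=
  ∀ i j, ContDiff ℝ 1 fun t => (c t : Matrix (Fin n) (Fin n) ℂ) i j

/-- The derivative of a curve in `SL(n, ℂ)`, as a matrix. -/
noncomputable def vel (c : ℝ → G n) (t : ℝ) : Matrix (Fin n) (Fin n) ℂ :=
  Matrix.of fun i j => deriv (fun s => (c s : Matrix (Fin n) (Fin n) ℂ) i j) t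

/-- The Riemannian norm of the tangent vector at time `t` of the curve `t ↦ c(t) u` in `Z = G / K`,
where `u` is the class of `1`. The metric is the `G`-invariant one that is given on `T_u Z ≅ p` by
the Killing form. Translating by `c(t)⁻¹`, the tangent vector becomes the image in `T_u Z` of
`c(t)⁻¹ c'(t) ∈ sl(n, ℂ)`, which corresponds to the `p`-component of this matrix. -/
noncomputable def speed (c : ℝ → G n) (t : ℝ) : ℝ :=
  let X := pPart ((((c t)⁻¹ : G n) : Matrix (Fin n) (Fin n) ℂ) * vel c t)
  Real.sqrt (killing X X)

/-- The length of the curve `[0, 1] → Z`, `t ↦ c(t) u`. -/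
noncomputable def length (c : ℝ → G n) : ℝ := ∫ t in (0 : ℝ)..1, speed c t

/-- The Riemannian distance on `Z`: the infimum of the lengths of the `C¹` curves from `x` to `y`.
Since `G → G / K` is a principal bundle, the `C¹` curves in `Z` are the curves `t ↦ c(t) u` with
`c` a `C¹` curve in `G`. (The distance is finite, because `SL(n, ℂ)` is connected.) -/
noncomputable def rdist (x y : Z n) : ℝ≥0∞ :=
  ⨅ (c : ℝ → G n) (_ : IsC1 c ∧ (c 0 : Z n) = x ∧ (c 1 : Z n) = y), ENNReal.ofReal (length c)

/-! ### The distance is symmetric, satisfies the triangle inequality, and is `G`-invariant -/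

lemma rdist_le {c : ℝ → G n} (hc : IsC1 c) :
    rdist (c 0 : Z n) (c 1 : Z n) ≤ ENNReal.ofReal (length c) :=
  iInf₂_le c ⟨hc, rfl, rfl⟩

lemma length_nonneg (c : ℝ → G n) : 0 ≤ length c :=
  intervalIntegral.integral_nonneg zero_le_one fun _ _ => Real.sqrt_nonneg _

lemma vel_mul_left (g : G n) {c : ℝ → G n} (hc : IsC1 c) (t : ℝ) :
    vel (fun s => g * c s) t = (g : Matrix (Fin n) (Fin n) ℂ) * vel c t := by
  ext i j
  simp only [vel, Matrix.of_apply, Matrix.SpecialLinearGroup.coe_mul, Matrix.mul_apply]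
  rw [deriv_fun_sum]
  · refine Finset.sum_congr rfl fun k _ => ?_
    rw [deriv_const_mul]
    exact ((hc k j).differentiable one_ne_zero).differentiableAt
  · intro k _
    exact (((hc k j).differentiable one_ne_zero).differentiableAt).const_mul _

lemma vel_mul_right (g : G n) {c : ℝ → G n} (hc : IsC1 c) (t : ℝ) :
    vel (fun s => c s * g) t = vel c t * (g : Matrix (Fin n) (Fin n) ℂ) := by
  ext i j
  simp only [vel, Matrix.of_apply, Matrix.SpecialLinearGroup.coe_mul, Matrix.mul_apply]
  rw [deriv_fun_sum]
  · refine Finset.sum_congr rfl fun k _ => ?_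
    rw [deriv_mul_const]
    exact ((hc i k).differentiable one_ne_zero).differentiableAt
  · intro k _
    exact (((hc i k).differentiable one_ne_zero).differentiableAt).mul_const _

lemma IsC1.mul {c d : ℝ → G n} (hc : IsC1 c) (hd : IsC1 d) : IsC1 fun t => c t * d t := by
  intro i j
  simp only [Matrix.SpecialLinearGroup.coe_mul, Matrix.mul_apply]
  exact ContDiff.sum fun k _ => (hc i k).mul (hd k j)

lemma isC1_const (g : G n) : IsC1 fun _ => g := fun _ _ => contDiff_const

lemma IsC1.comp {c : ℝ → G n} (hc : IsC1 c) {f : ℝ → ℝ} (hf : ContDiff ℝ 1 f) :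
    IsC1 fun t => c (f t) := fun i j => (hc i j).comp hf

lemma speed_mul_left (g : G n) {c : ℝ → G n} (hc : IsC1 c) (t : ℝ) :
    speed (fun s => g * c s) t = speed c t := by
  have : (((g * c t)⁻¹ : G n) : Matrix (Fin n) (Fin n) ℂ) * (vel (fun s => g * c s) t)
      = (((c t)⁻¹ : G n) : Matrix (Fin n) (Fin n) ℂ) * vel c t := by
    rw [vel_mul_left g hc, ← mul_assoc, ← Matrix.SpecialLinearGroup.coe_mul]
    congr 2
    rw [mul_inv_rev, inv_mul_cancel_right]
  simp only [speed, this]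

lemma speed_mul_right {g : G n} (hg : g ∈ K n) {c : ℝ → G n} (hc : IsC1 c) (t : ℝ) :
    speed (fun s => c s * g) t = speed c t := by
  have hg1 : (g : Matrix (Fin n) (Fin n) ℂ) * ((g⁻¹ : G n) : Matrix (Fin n) (Fin n) ℂ) = 1 := by
    rw [← Matrix.SpecialLinearGroup.coe_mul, mul_inv_cancel, Matrix.SpecialLinearGroup.coe_one]
  have hg2 : ((g⁻¹ : G n) : Matrix (Fin n) (Fin n) ℂ) = (g : Matrix (Fin n) (Fin n) ℂ)ᴴ :=
    (left_inv_eq_right_inv (Matrix.mem_unitaryGroup_iff'.1 hg) hg1).symm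
  set A := (((c t)⁻¹ : G n) : Matrix (Fin n) (Fin n) ℂ) * vel c t with hA
  have h1 : (((c t * g)⁻¹ : G n) : Matrix (Fin n) (Fin n) ℂ) * (vel (fun s => c s * g) t)
      = ((g⁻¹ : G n) : Matrix (Fin n) (Fin n) ℂ) * A * (g : Matrix (Fin n) (Fin n) ℂ) := by
    rw [vel_mul_right g hc, mul_inv_rev, Matrix.SpecialLinearGroup.coe_mul, hA]
    simp only [mul_assoc]
  have h2 : pPart (((g⁻¹ : G n) : Matrix (Fin n) (Fin n) ℂ) * A * (g : Matrix (Fin n) (Fin n) ℂ))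
      = ((g⁻¹ : G n) : Matrix (Fin n) (Fin n) ℂ) * pPart A * (g : Matrix (Fin n) (Fin n) ℂ) := by
    simp only [pPart, hg2, Matrix.conjTranspose_mul, Matrix.conjTranspose_conjTranspose,
      Matrix.mul_smul, Matrix.smul_mul, Matrix.mul_add, Matrix.add_mul, mul_assoc]
  have h3 : ∀ P : Matrix (Fin n) (Fin n) ℂ,
      killing (((g⁻¹ : G n) : Matrix (Fin n) (Fin n) ℂ) * P * (g : Matrix (Fin n) (Fin n) ℂ))
        (((g⁻¹ : G n) : Matrix (Fin n) (Fin n) ℂ) * P * (g : Matrix (Fin n) (Fin n) ℂ))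
        = killing P P := by
    intro P
    have : ((g⁻¹ : G n) : Matrix (Fin n) (Fin n) ℂ) * P * (g : Matrix (Fin n) (Fin n) ℂ)
        * (((g⁻¹ : G n) : Matrix (Fin n) (Fin n) ℂ) * P * (g : Matrix (Fin n) (Fin n) ℂ))
        = ((g⁻¹ : G n) : Matrix (Fin n) (Fin n) ℂ)
          * (P * ((g : Matrix (Fin n) (Fin n) ℂ) * ((g⁻¹ : G n) : Matrix (Fin n) (Fin n) ℂ)) * P
            * (g : Matrix (Fin n) (Fin n) ℂ)) := by
      simp only [mul_assoc]
    unfold killing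
    rw [this, hg1, mul_one, Matrix.trace_mul_comm, Matrix.mul_assoc, hg1, Matrix.mul_one]
  simp only [speed, ← hA, h1, h2, h3]

lemma speed_congr {c d : ℝ → G n} {t : ℝ} (h : c =ᶠ[𝓝 t] d) : speed c t = speed d t := by
  have h1 : vel c t = vel d t := by
    ext i j
    simp only [vel, Matrix.of_apply]
    apply Filter.EventuallyEq.deriv_eq
    filter_upwards [h] with s hs
    rw [hs]
  simp only [speed, h1, h.eq_of_nhds]

lemma speed_comp {c : ℝ → G n} (hc : IsC1 c) {f : ℝ → ℝ} (hf : Differentiable ℝ f) (t : ℝ) :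
    speed (fun s => c (f s)) t = |deriv f t| * speed c (f t) := by
  have h1 : vel (fun s => c (f s)) t = ((deriv f t : ℝ) : ℂ) • vel c (f t) := by
    ext i j
    simp only [vel, Matrix.of_apply, Matrix.smul_apply, smul_eq_mul]
    have := (((hc i j).differentiable one_ne_zero) (f t)).hasDerivAt.scomp t (hf t).hasDerivAt
    have h := this.deriv
    simp only [Function.comp_def] at h
    rw [h]
    simp
  have h2 : ∀ (r : ℝ) (A : Matrix (Fin n) (Fin n) ℂ),
      pPart ((r : ℂ) • A) = (r : ℂ) • pPart A := by
    intro r A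
    simp only [pPart, Matrix.conjTranspose_smul, smul_smul]
    simp only [RCLike.star_def, Complex.conj_ofReal, ← smul_add, smul_smul, mul_comm]
  have h3 : ∀ (r : ℝ) (A : Matrix (Fin n) (Fin n) ℂ),
      killing ((r : ℂ) • A) ((r : ℂ) • A) = r ^ 2 * killing A A := by
    intro r A
    simp only [killing, Matrix.smul_mul, Matrix.mul_smul, Matrix.trace_smul, smul_eq_mul,
      Complex.re_ofReal_mul]
    ring
  simp only [speed, h1, Matrix.mul_smul, h2, h3]
  rw [Real.sqrt_mul (sq_nonneg _), Real.sqrt_sq_eq_abs]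

lemma continuous_speed {c : ℝ → G n} (hc : IsC1 c) : Continuous (speed c) := by
  have h1 : Continuous fun t => (c t : Matrix (Fin n) (Fin n) ℂ) :=
    continuous_matrix fun i j => (hc i j).continuous
  have h2 : Continuous (vel c) :=
    continuous_matrix fun i j => (hc i j).continuous_deriv le_rfl
  have h3 : Continuous fun t => (((c t)⁻¹ : G n) : Matrix (Fin n) (Fin n) ℂ) := by
    simp only [Matrix.SpecialLinearGroup.coe_inv]
    exact h1.matrix_adjugate
  have h4 : Continuous fun t =>
      pPart ((((c t)⁻¹ : G n) : Matrix (Fin n) (Fin n) ℂ) * vel c t) := by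
    unfold pPart
    exact ((h3.matrix_mul h2).add (h3.matrix_mul h2).matrix_conjTranspose).const_smul (1 / 2 : ℂ)
  unfold speed killing
  exact Real.continuous_sqrt.comp
    (continuous_const.mul (Complex.continuous_re.comp (h4.matrix_mul h4).matrix_trace))

lemma rdist_smul (g : G n) (x y : Z n) : rdist (g • x) (g • y) = rdist x y := by
  have key : ∀ (g : G n) (x y : Z n), rdist (g • x) (g • y) ≤ rdist x y := by
    intro g x y
    refine le_iInf₂ fun c hc => ?_
    obtain ⟨hc, rfl, rfl⟩ := hc
    have h := rdist_le ((isC1_const g).mul hc)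
    have h2 : length (fun t => g * c t) = length c := by
      simp only [length, speed_mul_left g hc]
    rw [h2] at h
    exact h
  refine le_antisymm (key g x y) ?_
  simpa using key g⁻¹ (g • x) (g • y)

lemma rdist_self (x : Z n) : rdist x x = 0 := by
  obtain ⟨g, rfl⟩ := QuotientGroup.mk_surjective x
  have h := rdist_le (isC1_const g)
  have h2 : length (fun _ : ℝ => g) = 0 := by
    have : ∀ t, speed (fun _ : ℝ => g) t = 0 := by
      intro t
      have : vel (fun _ : ℝ => g) t = 0 := by
        ext i j
        simp [vel]
      simp [speed, this, pPart, killing]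
    simp [length, this]
  rw [h2] at h
  simpa using h

lemma rdist_comm (x y : Z n) : rdist x y = rdist y x := by
  have key : ∀ x y : Z n, rdist x y ≤ rdist y x := by
    intro x y
    refine le_iInf₂ fun c hc => ?_
    obtain ⟨hc, rfl, rfl⟩ := hc
    have hf : ContDiff ℝ 1 fun t : ℝ => 1 - t := by fun_prop
    have h := rdist_le (hc.comp hf)
    have h2 : length (fun t => c (1 - t)) = length c := by
      have : ∀ t, speed (fun t => c (1 - t)) t = speed c (1 - t) := by
        intro t
        rw [speed_comp hc (hf.differentiable one_ne_zero)]
        simp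
      simp only [length, this]
      rw [intervalIntegral.integral_comp_sub_left (fun t => speed c t)]
      simp
    rw [h2] at h
    simpa using h
  exact le_antisymm (key x y) (key y x)

lemma integral_speed_comp {c : ℝ → G n} (hc : IsC1 c) {f : ℝ → ℝ} (hf : ContDiff ℝ 1 f)
    (hm : Monotone f) (a b : ℝ) :
    ∫ t in a..b, speed (fun s => c (f s)) t = ∫ t in f a..f b, speed c t := by
  rw [← intervalIntegral.integral_comp_mul_deriv (f := f) (f' := deriv f)
    (fun t _ => ((hf.differentiable one_ne_zero) t).hasDerivAt)
    (hf.continuous_deriv le_rfl).continuousOn (continuous_speed hc)]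
  refine intervalIntegral.integral_congr fun t _ => ?_
  simp only [Function.comp_apply]
  rw [speed_comp hc (hf.differentiable one_ne_zero), abs_of_nonneg hm.deriv_nonneg, mul_comm]

lemma rdist_triangle (x y z : Z n) : rdist x z ≤ rdist x y + rdist y z := by
  have hσ : ContDiff ℝ 1 Real.smoothTransition := Real.smoothTransition.contDiff
  have hσm : Monotone Real.smoothTransition := Real.smoothTransition.monotone
  unfold rdist
  simp only [ENNReal.iInf_add, ENNReal.add_iInf]
  refine le_iInf₂ fun d hd => le_iInf₂ fun c hc => ?_
  obtain ⟨hc, rfl, hcy⟩ := hc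
  obtain ⟨hd, hdy, rfl⟩ := hd
  have hk : (d 0)⁻¹ * c 1 ∈ K n := QuotientGroup.eq.1 (hdy.trans hcy.symm)
  set k := (d 0)⁻¹ * c 1 with hkdef
  set d' : ℝ → G n := fun t => d t * k with hd'
  have hd'1 : IsC1 d' := hd.mul (isC1_const k)
  have hd'0 : d' 0 = c 1 := by simp [hd', hkdef]
  have hlen : length d' = length d := by simp only [length, hd', speed_mul_right hk hd]
  set f₁ : ℝ → ℝ := fun t => Real.smoothTransition (2 * t) with hf₁
  set f₂ : ℝ → ℝ := fun t => Real.smoothTransition (2 * t - 1) with hf₂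
  have h₁ : ContDiff ℝ 1 f₁ := hσ.comp (by fun_prop)
  have h₂ : ContDiff ℝ 1 f₂ := hσ.comp (by fun_prop)
  have m₁ : Monotone f₁ := fun a b h => hσm (by linarith)
  have m₂ : Monotone f₂ := fun a b h => hσm (by linarith)
  set e : ℝ → G n := fun t => c (f₁ t) * ((c 1)⁻¹ * d' (f₂ t)) with he
  have he1 : IsC1 e := (hc.comp h₁).mul ((isC1_const _).mul (hd'1.comp h₂))
  have e₁ : ∀ t ≤ (1 / 2 : ℝ), e t = c (f₁ t) := by
    intro t ht
    have : f₂ t = 0 := Real.smoothTransition.zero_of_nonpos (by linarith)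
    simp [he, this, hd'0]
  have e₂ : ∀ t, (1 / 2 : ℝ) ≤ t → e t = d' (f₂ t) := by
    intro t ht
    have : f₁ t = 1 := Real.smoothTransition.one_of_one_le (by linarith)
    simp [he, this]
  have a0 : f₁ 0 = 0 := by simp [hf₁, Real.smoothTransition.zero_of_nonpos]
  have a1 : f₁ (1 / 2) = 1 := Real.smoothTransition.one_of_one_le (by norm_num)
  have b0 : f₂ (1 / 2) = 0 := Real.smoothTransition.zero_of_nonpos (by norm_num)
  have b1 : f₂ 1 = 1 := Real.smoothTransition.one_of_one_le (by norm_num)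
  have E0 : e 0 = c 0 := by rw [e₁ 0 (by norm_num), a0]
  have E1 : (e 1 : Z n) = (d 1 : Z n) := by
    rw [e₂ 1 (by norm_num), b1, hd']
    exact QuotientGroup.mk_mul_of_mem _ hk
  have L₁ : ∫ t in (0 : ℝ)..(1 / 2), speed e t = length c := by
    have h := integral_speed_comp hc h₁ m₁ 0 (1 / 2)
    rw [a0, a1] at h
    rw [length, ← h]
    refine intervalIntegral.integral_congr_ae ?_
    filter_upwards [MeasureTheory.Measure.ae_ne MeasureTheory.volume (1 / 2 : ℝ)] with t ht1 ht
    rw [Set.uIoc_of_le (by norm_num)] at ht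
    refine speed_congr ?_
    filter_upwards [Iio_mem_nhds (lt_of_le_of_ne ht.2 ht1)] with s hs
    exact e₁ s hs.le
  have L₂ : ∫ t in (1 / 2 : ℝ)..1, speed e t = length d' := by
    have h := integral_speed_comp hd'1 h₂ m₂ (1 / 2) 1
    rw [b0, b1] at h
    rw [length, ← h]
    refine intervalIntegral.integral_congr_ae ?_
    refine Filter.Eventually.of_forall fun t ht => ?_
    rw [Set.uIoc_of_le (by norm_num)] at ht
    refine speed_congr ?_
    filter_upwards [Ioi_mem_nhds ht.1] with s hs
    exact e₂ s (le_of_lt hs)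
  have L : length e = length c + length d := by
    rw [← hlen, ← L₁, ← L₂, length]
    exact (intervalIntegral.integral_add_adjacent_intervals
      ((continuous_speed he1).intervalIntegrable _ _)
      ((continuous_speed he1).intervalIntegrable _ _)).symm
  rw [← ENNReal.ofReal_add (length_nonneg c) (length_nonneg d), ← L]
  exact iInf₂_le e ⟨he1, by rw [E0], E1⟩

/-! ### Geodesics and the boundary at infinity -/

/-- `γ` is a unit speed geodesic of the Riemannian manifold `Z`, i.e. a curve, parametrized by arc
length, that is locally distance minimizing. Here the interval `I` of definition is `ℝ` or `ℝ≥0`. -/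
def IsUnitSpeedGeodesic {I : Type} [PseudoEMetricSpace I] (γ : I → Z n) : Prop :=
  ∀ t : I, ∃ U ∈ 𝓝 t, ∀ a ∈ U, ∀ b ∈ U, rdist (γ a) (γ b) = edist a b

/-- A ray (unit speed half-geodesic) in `Z`, emanating at an arbitrary point of `Z`. -/
structure Ray (n : ℕ) where
  toFun : ℝ≥0 → Z n
  isGeodesic : IsUnitSpeedGeodesic toFun

/-- A complete geodesic `ℝ → Z`, parametrized with unit speed. -/
structure GeodesicLine (n : ℕ) where
  toFun : ℝ → Z n
  isGeodesic : IsUnitSpeedGeodesic toFun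

/-- Two rays are asymptotic if their distance is bounded. -/
def Asymptotic (γ₁ γ₂ : Ray n) : Prop :=
  ∃ C : ℝ≥0, ∀ t : ℝ≥0, rdist (γ₁.toFun t) (γ₂.toFun t) ≤ C

/-- Asymptoticity is an equivalence relation on rays. -/
instance asymptoticSetoid (n : ℕ) : Setoid (Ray n) where
  r := Asymptotic
  iseqv :=
    { refl := fun γ => ⟨0, fun t => by simp [rdist_self]⟩
      symm := fun ⟨C, hC⟩ => ⟨C, fun t => by rw [rdist_comm]; exact hC t⟩
      trans := fun ⟨C, hC⟩ ⟨D, hD⟩ => ⟨C + D, fun t => by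
        rw [ENNReal.coe_add]
        exact (rdist_triangle _ _ _).trans (add_le_add (hC t) (hD t))⟩ }

/-- The boundary at infinity `Z(∞)`: the set of classes of asymptotic rays. -/
def Boundary (n : ℕ) : Type := Quotient (asymptoticSetoid n)

/-- The translate of a ray by an element of `G`. -/
def Ray.translate (g : G n) (γ : Ray n) : Ray n where
  toFun t := g • γ.toFun t
  isGeodesic := by
    intro t
    obtain ⟨U, hU, h⟩ := γ.isGeodesic t
    exact ⟨U, hU, fun a ha b hb => by rw [rdist_smul, h a ha b hb]⟩

/-- The action of `G` on `Z(∞)` induced by its isometric action on `Z`. -/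
instance (n : ℕ) : MulAction (G n) (Boundary n) where
  smul g := Quotient.map (Ray.translate g) fun _ _ ⟨C, hC⟩ =>
    ⟨C, fun t => (rdist_smul g _ _).le.trans (hC t)⟩
  one_smul z := by
    induction z using Quotient.inductionOn with
    | h γ =>
      change (Quotient.mk _ (Ray.translate 1 γ) : Quotient (asymptoticSetoid n)) = _
      congr 1
      simp [Ray.translate]
  mul_smul g h z := by
    induction z using Quotient.inductionOn with
    | h γ =>
      change (Quotient.mk _ (Ray.translate (g * h) γ) : Quotient (asymptoticSetoid n))
        = Quotient.mk _ (Ray.translate g (Ray.translate h γ))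
      congr 1
      simp [Ray.translate, mul_smul]

/-- The ray `t ↦ γ(t)`, `t ≥ 0`, of a complete geodesic `γ`. -/
def GeodesicLine.posRay (γ : GeodesicLine n) : Ray n where
  toFun t := γ.toFun (t : ℝ)
  isGeodesic := by
    intro t
    obtain ⟨U, hU, h⟩ := γ.isGeodesic (t : ℝ)
    exact ⟨_, NNReal.continuous_coe.continuousAt hU, fun a ha b hb => h _ ha _ hb⟩

/-- The ray `t ↦ γ(-t)`, `t ≥ 0`, of a complete geodesic `γ`. -/
def GeodesicLine.negRay (γ : GeodesicLine n) : Ray n where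
  toFun t := γ.toFun (-(t : ℝ))
  isGeodesic := by
    intro t
    obtain ⟨U, hU, h⟩ := γ.isGeodesic (-(t : ℝ))
    refine ⟨_, NNReal.continuous_coe.neg.continuousAt hU, fun a ha b hb => ?_⟩
    exact (h _ ha _ hb).trans (edist_neg_neg _ _)

/-- The geodesic `γ` joins the boundary points `z` and `z'`: its two ends represent them. -/
def GeodesicLine.Joins (γ : GeodesicLine n) (z z' : Boundary n) : Prop :=
  (Quotient.mk _ γ.posRay : Boundary n) = z ∧ (Quotient.mk _ γ.negRay : Boundary n) = z'

/-- The boundary point `z` corresponds to the subspace `W` of `ℂⁿ`: the stabilizer of `z` in `G` is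
the (maximal parabolic, if `W` is nontrivial) subgroup of all elements of `G` that preserve `W`. -/
def Corresponds (W : Submodule ℂ (Fin n → ℂ)) (z : Boundary n) : Prop :=
  ∀ g : G n, g ∈ MulAction.stabilizer (G n) z ↔
    W.map (Matrix.mulVecLin (g : Matrix (Fin n) (Fin n) ℂ)) = W

end SymSpace

open scoped ComplexOrder

namespace SymSpace

variable {n : ℕ}

/-! The proof makes geodesics and asymptoticity explicit and then does linear algebra.

Metric. By the Cartan decomposition each class in `Z` is that of some `k exp(d)` with `k ∈ K` and
`d` traceless real diagonal; put `lg g = k d kᴴ`, the inverse of the exponential map at `u`. The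
Frobenius norm of `lg h - lg g` is at most half that of `defect (g⁻¹ * h)`: entry by entry this is
`|x| ≤ |sinh x|` (`norm_conj_sub_le`). Since the derivative of the defect at the identity is twice
the `p`-component, integration along curves shows that `lg` does not increase distances
(`le_rdist`), while distances from `u` are preserved. So no smooth Riemannian machinery is needed.

Geodesics. A minimizing segment issuing from `u` is sent by `lg` to a curve with equality in the
triangle inequality, thus to a straight segment by strict convexity of Euclidean space. Hence it is
an orbit `g exp(t d) u`; local pieces are glued by `flow_unique`.

Boundary. Points of `Z` stay at bounded distance from `u` iff the entries of their representatives
stay bounded. With `h = g⁻¹ g'`, the entries of `exp(-t d) h exp(t d')` have modulus `|h i j| e^{t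
(d' j - d i)}`, so the rays given by `(g, d)` and `(g', d')` are asymptotic iff `h i j = 0` whenever
`d i < d' j` (`bpt_eq_iff`). In particular stabilizers are conjugates of block triangular groups.

Subspaces. Such a stabilizer is that of `W` iff `W = g cs(S)` and `d` takes just two values, the
larger one on `S` (`corresponds_bpt_iff`). Trace zero and unit norm then fix `d` in terms of `S`,
which gives uniqueness. Reversing a line replaces `d` by `-d`, hence `S` by its complement, so the
subspaces at the two ends are complementary; conversely, every direct sum decomposition is a
translate of a coordinate one. -/

/-- Square complex matrices of size `n`. -/
abbrev Mat (n : ℕ) : Type := Matrix (Fin n) (Fin n) ℂ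

/-! ### Frobenius norm and unitary invariance -/

/-- The entries of a matrix, as a vector of a Euclidean space. -/
def vecM : Mat n →ₗ[ℂ] EuclideanSpace ℂ (Fin n × Fin n) where
  toFun A := WithLp.toLp 2 fun p => A p.1 p.2
  map_add' _ _ := rfl
  map_smul' _ _ := rfl

@[simp] lemma vecM_apply (A : Mat n) (p : Fin n × Fin n) : vecM A p = A p.1 p.2 := rfl

lemma vecM_injective : Function.Injective (vecM (n := n)) := by
  intro A B h
  ext i j
  exact congrArg (fun v : EuclideanSpace ℂ (Fin n × Fin n) => v (i, j)) h

lemma norm_vecM_sq (A : Mat n) : ‖vecM A‖ ^ 2 = ∑ i, ∑ j, ‖A i j‖ ^ 2 := by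
  rw [EuclideanSpace.norm_sq_eq, Fintype.sum_prod_type]
  rfl

lemma norm_vecM_sq_eq_trace (A : Mat n) : ‖vecM A‖ ^ 2 = (A * Aᴴ).trace.re := by
  rw [norm_vecM_sq, Matrix.trace, Complex.re_sum]
  refine Finset.sum_congr rfl fun i _ => ?_
  rw [Matrix.diag_apply, Matrix.mul_apply, Complex.re_sum]
  refine Finset.sum_congr rfl fun j _ => ?_
  rw [Matrix.conjTranspose_apply, Complex.star_def, Complex.mul_conj, Complex.ofReal_re,
    Complex.normSq_eq_norm_sq]

lemma norm_vecM_unitary {U V : Mat n} (hU : Uᴴ * U = 1) (hV : V * Vᴴ = 1) (A : Mat n) :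
    ‖vecM (U * A * V)‖ = ‖vecM A‖ := by
  have : ‖vecM (U * A * V)‖ ^ 2 = ‖vecM A‖ ^ 2 := by
    rw [norm_vecM_sq_eq_trace, norm_vecM_sq_eq_trace]
    congr 1
    simp only [Matrix.conjTranspose_mul]
    rw [show U * A * V * (Vᴴ * (Aᴴ * Uᴴ)) = U * (A * (V * Vᴴ) * Aᴴ * Uᴴ) by
      simp only [Matrix.mul_assoc], hV, Matrix.mul_one, Matrix.trace_mul_comm, Matrix.mul_assoc,
      hU, Matrix.mul_one]
  exact (sq_eq_sq₀ (norm_nonneg _) (norm_nonneg _)).1 this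

lemma coe_inv_mul_coe (g : G n) : ((g⁻¹ : G n) : Mat n) * (g : Mat n) = 1 := by
  rw [← Matrix.SpecialLinearGroup.coe_mul, inv_mul_cancel, Matrix.SpecialLinearGroup.coe_one]

lemma mem_K_iff {k : G n} : k ∈ K n ↔ (k : Mat n) * (k : Mat n)ᴴ = 1 :=
  Matrix.mem_unitaryGroup_iff

lemma mem_K_iff' {k : G n} : k ∈ K n ↔ (k : Mat n)ᴴ * (k : Mat n) = 1 :=
  Matrix.mem_unitaryGroup_iff'

lemma coe_inv_of_mem_K {k : G n} (hk : k ∈ K n) : ((k⁻¹ : G n) : Mat n) = (k : Mat n)ᴴ :=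
  left_inv_eq_right_inv (coe_inv_mul_coe k) (mem_K_iff.1 hk)

/-! ### The diagonal subgroup `exp(T)` -/

/-- The real vectors with vanishing sum: a maximal abelian subspace of `p`, consisting of diagonal
matrices. -/
def T (n : ℕ) : Submodule ℝ (Fin n → ℝ) where
  carrier := {d | ∑ i, d i = 0}
  add_mem' := by
    intro a b ha hb
    simp_all [Finset.sum_add_distrib]
  zero_mem' := by simp
  smul_mem' := by
    intro c a ha
    simp_all [← Finset.mul_sum]

lemma T.sum_eq_zero (d : T n) : ∑ i, (d : Fin n → ℝ) i = 0 := d.2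

/-- The matrix exponential of a traceless real diagonal matrix. -/
noncomputable def dexp (d : T n) : G n :=
  ⟨Matrix.diagonal fun i => ((Real.exp ((d : Fin n → ℝ) i) : ℝ) : ℂ), by
    rw [Matrix.det_diagonal, ← Complex.ofReal_prod, ← Real.exp_sum, d.2]
    simp⟩

lemma coe_dexp (d : T n) : (dexp d : Mat n)
    = Matrix.diagonal fun i => ((Real.exp ((d : Fin n → ℝ) i) : ℝ) : ℂ) := rfl

lemma dexp_add (a b : T n) : dexp (a + b) = dexp a * dexp b := by
  apply Subtype.ext
  rw [Matrix.SpecialLinearGroup.coe_mul]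
  simp only [coe_dexp, Matrix.diagonal_mul_diagonal]
  congr 1
  ext i
  simp [Real.exp_add]

lemma dexp_zero : dexp (0 : T n) = 1 := by
  apply Subtype.ext
  simp [coe_dexp]

lemma dexp_neg (a : T n) : dexp (-a) = (dexp a)⁻¹ := by
  rw [eq_inv_iff_mul_eq_one, ← dexp_add, neg_add_cancel, dexp_zero]

lemma dexp_conjTranspose (d : T n) : (dexp d : Mat n)ᴴ = dexp d := by
  rw [coe_dexp, Matrix.diagonal_conjTranspose]
  congr 1
  ext i
  simp [-Complex.ofReal_exp]

/-- A traceless real diagonal matrix. -/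
def dmat (d : T n) : Mat n := Matrix.diagonal fun i => (((d : Fin n → ℝ) i : ℝ) : ℂ)

/-! ### The defect and the contraction inequality -/

/-- The anti-selfadjoint defect `g - (g⁻¹)ᴴ`, which vanishes exactly on `K`. -/
def defect (g : G n) : Mat n := (g : Mat n) - ((g⁻¹ : G n) : Mat n)ᴴ

/-- On `K` the map `g ↦ (g⁻¹)ᴴ` is the identity, so the defect is equivariant on both sides and its
norm descends to `K \ G / K`. -/
lemma defect_mul {k l : G n} (hk : k ∈ K n) (hl : l ∈ K n) (g : G n) :
    defect (k * g * l) = (k : Mat n) * defect g * (l : Mat n) := by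
  have h1 := coe_inv_of_mem_K hk
  have h2 := coe_inv_of_mem_K hl
  simp only [defect, mul_inv_rev, Matrix.SpecialLinearGroup.coe_mul, h1, h2,
    Matrix.conjTranspose_mul, Matrix.conjTranspose_conjTranspose, Matrix.mul_sub, Matrix.sub_mul,
    Matrix.mul_assoc]

lemma norm_defect_mul {k l : G n} (hk : k ∈ K n) (hl : l ∈ K n) (g : G n) :
    ‖vecM (defect (k * g * l))‖ = ‖vecM (defect g)‖ := by
  rw [defect_mul hk hl, norm_vecM_unitary (mem_K_iff'.1 hk) (mem_K_iff.1 hl)]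

lemma defect_eq_zero {k : G n} (hk : k ∈ K n) : defect k = 0 := by
  rw [defect, coe_inv_of_mem_K hk, Matrix.conjTranspose_conjTranspose, sub_self]

/-- This is `|x| ≤ |sinh x|`, the only place where nonpositive curvature enters. -/
lemma two_mul_abs_le_exp_sub (x : ℝ) : 2 * |x| ≤ |Real.exp x - Real.exp (-x)| := by
  have h := Real.sinh_eq x
  have h2 : Real.exp x - Real.exp (-x) = 2 * Real.sinh x := by rw [h]; ring
  rw [h2, abs_mul, abs_two, Real.abs_sinh]
  have := Real.self_le_sinh_iff.2 (abs_nonneg x)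
  linarith

/-- The inequality behind the fact that the exponential map of `Z` does not decrease distances. -/
lemma norm_conj_sub_le {k l : G n} (hk : k ∈ K n) (hl : l ∈ K n) (a b : T n) :
    2 * ‖vecM ((l : Mat n) * dmat b * (l : Mat n)ᴴ - (k : Mat n) * dmat a * (k : Mat n)ᴴ)‖
      ≤ ‖vecM (defect ((k * dexp a)⁻¹ * (l * dexp b)))‖ := by
  set w : G n := k⁻¹ * l with hw
  have hwK : w ∈ K n := mul_mem (inv_mem hk) hl
  have hk1 := mem_K_iff.1 hk
  have hk2 := mem_K_iff'.1 hk
  have hl1 := mem_K_iff.1 hl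
  have hl2 := mem_K_iff'.1 hl
  have hwc : (w : Mat n) = (k : Mat n)ᴴ * (l : Mat n) := by
    rw [hw, Matrix.SpecialLinearGroup.coe_mul, coe_inv_of_mem_K hk]
  -- Unitary invariance removes `k` and `l` except for `w = k⁻¹ l`. Entry `(i, j)` then carries the
  -- factor `b j - a i` on the left and `2 sinh (b j - a i)` on the right, both times `w i j`.
  have e1 : ‖vecM ((l : Mat n) * dmat b * (l : Mat n)ᴴ - (k : Mat n) * dmat a * (k : Mat n)ᴴ)‖
      = ‖vecM ((w : Mat n) * dmat b - dmat a * (w : Mat n))‖ := by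
    rw [← norm_vecM_unitary (U := (k : Mat n)ᴴ) (V := (l : Mat n)) (by simpa using hk1) hl1]
    congr 2
    rw [hwc, Matrix.mul_sub, Matrix.sub_mul]
    congr 1
    · simp only [Matrix.mul_assoc, hl2, Matrix.mul_one]
    · simp only [← Matrix.mul_assoc, hk2, Matrix.one_mul]
  have e2 : (k * dexp a)⁻¹ * (l * dexp b) = dexp (-a) * w * dexp b := by
    rw [dexp_neg, hw]; group
  have e3 : ((dexp (-a) * w * dexp b)⁻¹ : G n) = dexp (-b) * w⁻¹ * dexp a := by
    rw [dexp_neg, dexp_neg]; group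
  have e4 : defect (dexp (-a) * w * dexp b)
      = (dexp (-a) : Mat n) * w * (dexp b : Mat n) - (dexp a : Mat n) * w * (dexp (-b) : Mat n) := by
    rw [defect, e3]
    simp only [Matrix.SpecialLinearGroup.coe_mul, Matrix.conjTranspose_mul, dexp_conjTranspose,
      coe_inv_of_mem_K hwK, Matrix.conjTranspose_conjTranspose, Matrix.mul_assoc]
  rw [e1, e2, e4]
  have key : (2 * ‖vecM ((w : Mat n) * dmat b - dmat a * (w : Mat n))‖) ^ 2
      ≤ ‖vecM ((dexp (-a) : Mat n) * (w : Mat n) * (dexp b : Mat n)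
        - (dexp a : Mat n) * (w : Mat n) * (dexp (-b) : Mat n))‖ ^ 2 := by
    rw [mul_pow, norm_vecM_sq, norm_vecM_sq, Finset.mul_sum]
    refine Finset.sum_le_sum fun i _ => ?_
    rw [Finset.mul_sum]
    refine Finset.sum_le_sum fun j _ => ?_
    simp only [dmat, coe_dexp, Matrix.sub_apply, Matrix.mul_diagonal, Matrix.diagonal_mul]
    have h := two_mul_abs_le_exp_sub ((b : Fin n → ℝ) j - (a : Fin n → ℝ) i)
    have h1 : (w : Mat n) i j * (((b : Fin n → ℝ) j : ℝ) : ℂ)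
        - (((a : Fin n → ℝ) i : ℝ) : ℂ) * (w : Mat n) i j
        = (((b : Fin n → ℝ) j - (a : Fin n → ℝ) i : ℝ) : ℂ) * (w : Mat n) i j := by
      push_cast; ring
    have h2 : ((Real.exp (((-a : T n) : Fin n → ℝ) i) : ℝ) : ℂ) * (w : Mat n) i j
          * ((Real.exp ((b : Fin n → ℝ) j) : ℝ) : ℂ)
        - ((Real.exp ((a : Fin n → ℝ) i) : ℝ) : ℂ) * (w : Mat n) i j
          * ((Real.exp (((-b : T n) : Fin n → ℝ) j) : ℝ) : ℂ)
        = ((Real.exp ((b : Fin n → ℝ) j - (a : Fin n → ℝ) i)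
          - Real.exp (-((b : Fin n → ℝ) j - (a : Fin n → ℝ) i)) : ℝ) : ℂ) * (w : Mat n) i j := by
      have : -((b : Fin n → ℝ) j - (a : Fin n → ℝ) i)
          = (a : Fin n → ℝ) i + -((b : Fin n → ℝ) j) := by ring
      rw [this, sub_eq_add_neg ((b : Fin n → ℝ) j), Real.exp_add, Real.exp_add]
      simp only [Submodule.coe_neg, Pi.neg_apply]
      push_cast; ring
    rw [h1, h2, norm_mul, norm_mul, Complex.norm_real, Complex.norm_real, Real.norm_eq_abs,
      Real.norm_eq_abs, mul_pow, mul_pow, ← mul_assoc]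
    refine mul_le_mul_of_nonneg_right ?_ (sq_nonneg _)
    calc (2 : ℝ) ^ 2 * |(b : Fin n → ℝ) j - (a : Fin n → ℝ) i| ^ 2
        = (2 * |(b : Fin n → ℝ) j - (a : Fin n → ℝ) i|) ^ 2 := by ring
      _ ≤ _ := pow_le_pow_left₀ (by positivity) h 2
  exact (sq_le_sq₀ (by positivity) (norm_nonneg _)).1 key

/-! ### Cartan decomposition and the logarithm -/

/-- Cartan decomposition `G = K exp(T) K`. -/
lemma exists_cartan [NeZero n] (g : G n) :
    ∃ k ∈ K n, ∃ d : T n, ∃ l ∈ K n, g = k * dexp d * l := by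
  set H : Mat n := (g : Mat n) * (g : Mat n)ᴴ with hH
  have hunit : IsUnit (g : Mat n) := by
    rw [Matrix.isUnit_iff_isUnit_det, g.2]; exact isUnit_one
  have hpos : H.PosDef := by
    exact Matrix.PosDef.mul_conjTranspose_self _ (Matrix.vecMul_injective_of_isUnit hunit)
  have hherm := hpos.isHermitian
  set U : Matrix.unitaryGroup (Fin n) ℂ := hherm.eigenvectorUnitary with hU
  have hspec : H = (U : Mat n) * Matrix.diagonal (fun i => ((hherm.eigenvalues i : ℝ) : ℂ))
      * (U : Mat n)ᴴ := by
    have := hherm.spectral_theorem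
    rw [Unitary.conjStarAlgAut_apply] at this
    exact this
  have hU1 : (U : Mat n) * (U : Mat n)ᴴ = 1 := Matrix.mem_unitaryGroup_iff.1 U.2
  have hev : ∀ i, 0 < hherm.eigenvalues i := hpos.eigenvalues_pos
  have hdet : H.det = 1 := by
    rw [hH, Matrix.det_mul, Matrix.det_conjTranspose, g.2]; simp
  have hprod : ∏ i, hherm.eigenvalues i = 1 := by
    have := hherm.det_eq_prod_eigenvalues
    rw [hdet] at this
    have h2 : ((∏ i, hherm.eigenvalues i : ℝ) : ℂ) = 1 := by
      rw [this]; push_cast; rfl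
    exact_mod_cast h2
  -- The eigenvector matrix is only unitary; multiplying it by an `n`-th root of the inverse
  -- determinant puts it in `SU(n)` without changing conjugation by it.
  obtain ⟨ζ, hζ⟩ := IsAlgClosed.exists_pow_nat_eq ((U : Mat n).det)⁻¹ (NeZero.pos n)
  have hUdet : ‖(U : Mat n).det‖ = 1 := by
    have h := congrArg Matrix.det hU1
    rw [Matrix.det_mul, Matrix.det_conjTranspose, Matrix.det_one, Complex.star_def,
      Complex.mul_conj] at h
    have h2 : Complex.normSq (U : Mat n).det = 1 := by exact_mod_cast h
    rw [Complex.normSq_eq_norm_sq] at h2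
    exact (pow_eq_one_iff_of_nonneg (norm_nonneg _) two_ne_zero).1 h2
  have hζn : ‖ζ‖ = 1 := by
    have h := congrArg norm hζ
    rw [norm_pow, norm_inv, hUdet, inv_one] at h
    exact (pow_eq_one_iff_of_nonneg (norm_nonneg _) (NeZero.ne n)).1 h
  have hζs : ζ * star ζ = 1 := by
    rw [Complex.star_def, Complex.mul_conj, Complex.normSq_eq_norm_sq, hζn]; simp
  let k : G n := ⟨ζ • (U : Mat n), by
    rw [Matrix.det_smul, Fintype.card_fin, hζ]
    refine inv_mul_cancel₀ fun h => ?_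
    rw [h, norm_zero] at hUdet
    exact zero_ne_one hUdet⟩
  have hkc : (k : Mat n) = ζ • (U : Mat n) := rfl
  have hkK : k ∈ K n := by
    rw [mem_K_iff, hkc, Matrix.conjTranspose_smul, Matrix.smul_mul, Matrix.mul_smul, smul_smul, hζs,
      hU1, one_smul]
  -- Halved because the eigenvalues are those of `g gᴴ`; the trace vanishes because `det (g gᴴ) =
  -- 1`.
  let d : T n := ⟨fun i => Real.log (hherm.eigenvalues i) / 2, by
    change ∑ i, Real.log (hherm.eigenvalues i) / 2 = 0
    rw [← Finset.sum_div, ← Real.log_prod (fun i _ => (hev i).ne'), hprod]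
    simp⟩
  have hdd : (dexp d : Mat n) * (dexp d : Mat n)
      = Matrix.diagonal (fun i => ((hherm.eigenvalues i : ℝ) : ℂ)) := by
    rw [coe_dexp, Matrix.diagonal_mul_diagonal]
    congr 1
    ext i
    rw [← Complex.ofReal_mul, ← Real.exp_add]
    change ((Real.exp (Real.log (hherm.eigenvalues i) / 2 + Real.log (hherm.eigenvalues i) / 2)
      : ℝ) : ℂ) = _
    rw [add_halves, Real.exp_log (hev i)]
  have hkH : H = (k : Mat n) * (dexp d : Mat n) * (dexp d : Mat n) * (k : Mat n)ᴴ := by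
    rw [Matrix.mul_assoc (k : Mat n), hdd]
    refine hspec.trans ?_
    rw [hkc, Matrix.conjTranspose_smul, Matrix.smul_mul,
      Matrix.smul_mul, Matrix.mul_smul, smul_smul, hζs, one_smul]
  refine ⟨k, hkK, d, (k * dexp d)⁻¹ * g, ?_, by group⟩
  rw [mem_K_iff]
  set q := k * dexp d with hq
  have hqq : H = (q : Mat n) * (q : Mat n)ᴴ := by
    rw [hkH, hq, Matrix.SpecialLinearGroup.coe_mul, Matrix.conjTranspose_mul, dexp_conjTranspose]
    simp only [Matrix.mul_assoc]
  rw [Matrix.SpecialLinearGroup.coe_mul, Matrix.conjTranspose_mul]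
  have e : ((q⁻¹ : G n) : Mat n) * (g : Mat n) * ((g : Mat n)ᴴ * ((q⁻¹ : G n) : Mat n)ᴴ)
      = ((q⁻¹ : G n) : Mat n) * H * ((q⁻¹ : G n) : Mat n)ᴴ := by
    rw [hH]; simp only [Matrix.mul_assoc]
  rw [e, hqq, ← Matrix.mul_assoc, coe_inv_mul_coe, Matrix.one_mul, ← Matrix.conjTranspose_mul,
    coe_inv_mul_coe, Matrix.conjTranspose_one]

/-- Half the logarithm of `g gᴴ`, a hermitian matrix that depends only on the class of `g` in `Z`:
the inverse of the exponential map of `Z` at the base point. -/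
noncomputable def lg [NeZero n] (g : G n) : Mat n :=
  ((exists_cartan g).choose : Mat n) * dmat (exists_cartan g).choose_spec.2.choose
    * ((exists_cartan g).choose : Mat n)ᴴ

lemma exists_lg_eq [NeZero n] (g : G n) : ∃ k ∈ K n, ∃ d : T n, ∃ l ∈ K n,
    g = k * dexp d * l ∧ lg g = (k : Mat n) * dmat d * (k : Mat n)ᴴ := by
  have h := (exists_cartan g).choose_spec
  obtain ⟨l, hl, e⟩ := h.2.choose_spec
  exact ⟨_, h.1, _, l, hl, e, rfl⟩

lemma norm_lg_sub_le [NeZero n] (g h : G n) :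
    2 * ‖vecM (lg h - lg g)‖ ≤ ‖vecM (defect (g⁻¹ * h))‖ := by
  obtain ⟨k, hk, d, l, hl, hg, eg⟩ := exists_lg_eq g
  obtain ⟨k', hk', d', l', hl', hh, eh⟩ := exists_lg_eq h
  rw [eg, eh]
  refine (norm_conj_sub_le hk hk' d d').trans_eq ?_
  have : g⁻¹ * h = l⁻¹ * ((k * dexp d)⁻¹ * (k' * dexp d')) * l' := by
    rw [hg, hh]; group
  rw [this, norm_defect_mul (inv_mem hl) hl']

lemma lg_congr [NeZero n] {g h : G n} (e : (g : Z n) = h) : lg g = lg h := by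
  have h1 := norm_lg_sub_le g h
  rw [defect_eq_zero (QuotientGroup.eq.1 e), map_zero, norm_zero] at h1
  have h2 : vecM (lg h - lg g) = 0 := by
    rw [← norm_le_zero_iff]; linarith
  have h3 : lg h - lg g = 0 := vecM_injective (h2.trans (map_zero vecM).symm)
  exact (sub_eq_zero.1 h3).symm

/-- `lg` is defined through a chosen decomposition; any other one differs by a right factor in `K`,
where the defect vanishes, so the contraction inequality forces the same value. -/
lemma lg_frame [NeZero n] {k : G n} (hk : k ∈ K n) (d : T n) :
    lg (k * dexp d) = (k : Mat n) * dmat d * (k : Mat n)ᴴ := by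
  obtain ⟨k', hk', d', l', hl', hh, eh⟩ := exists_lg_eq (k * dexp d)
  rw [eh]
  have h1 := norm_conj_sub_le hk hk' d d'
  have : (k * dexp d)⁻¹ * (k' * dexp d') = l'⁻¹ := by
    rw [hh]; group
  rw [this, defect_eq_zero (inv_mem hl'), map_zero, norm_zero] at h1
  have h2 : vecM ((k' : Mat n) * dmat d' * (k' : Mat n)ᴴ - (k : Mat n) * dmat d * (k : Mat n)ᴴ)
      = 0 := by
    rw [← norm_le_zero_iff]; linarith
  exact sub_eq_zero.1 (vecM_injective (h2.trans (map_zero vecM).symm))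

lemma lg_dexp [NeZero n] (d : T n) : lg (dexp d) = dmat d := by
  have := lg_frame (one_mem (K n)) d
  simpa using this

lemma dmat_zero : dmat (0 : T n) = 0 := by
  simp [dmat]

lemma lg_one [NeZero n] : lg (1 : G n) = 0 := by
  rw [← dexp_zero, lg_dexp, dmat_zero]

lemma dmat_smul (t : ℝ) (d : T n) : dmat (t • d) = (t : ℂ) • dmat d := by
  rw [dmat, dmat, ← Matrix.diagonal_smul]
  congr 1
  ext i
  simp

lemma dmat_conjTranspose (d : T n) : (dmat d)ᴴ = dmat d := by
  rw [dmat, Matrix.diagonal_conjTranspose]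
  congr 1
  ext i
  simp

/-! ### Speed, length and distance from the base point -/

/-- The Riemannian norm of a traceless real diagonal matrix. -/
noncomputable def dn (d : T n) : ℝ := Real.sqrt (4 * n) * ‖vecM (dmat d)‖

lemma dn_nonneg (d : T n) : 0 ≤ dn d := by unfold dn; positivity

lemma dn_smul (t : ℝ) (d : T n) : dn (t • d) = |t| * dn d := by
  rw [dn, dmat_smul, map_smul, norm_smul, Complex.norm_real, Real.norm_eq_abs, dn]
  ring

lemma dn_sq (d : T n) : dn d ^ 2 = 4 * n * ∑ i, (d : Fin n → ℝ) i ^ 2 := by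
  rw [dn, mul_pow, Real.sq_sqrt (by positivity), norm_vecM_sq]
  congr 1
  refine Finset.sum_congr rfl fun i _ => ?_
  rw [Finset.sum_eq_single i]
  · simp [dmat]
  · intro j _ hj
    simp [dmat, Matrix.diagonal_apply_ne _ hj.symm]
  · simp

lemma pPart_conjTranspose (A : Mat n) : (pPart A)ᴴ = pPart A := by
  simp [pPart, Matrix.conjTranspose_smul, add_comm]

lemma sqrt_killing_of_isHermitian {A : Mat n} (hA : Aᴴ = A) :
    Real.sqrt (killing A A) = Real.sqrt (4 * n) * ‖vecM A‖ := by
  have : killing A A = 4 * n * ‖vecM A‖ ^ 2 := by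
    rw [norm_vecM_sq_eq_trace, hA, killing]
  rw [this, Real.sqrt_mul (by positivity), Real.sqrt_sq (norm_nonneg _)]

lemma speed_eq (c : ℝ → G n) (t : ℝ) : speed c t = Real.sqrt (4 * n)
    * ‖vecM (pPart ((((c t)⁻¹ : G n) : Mat n) * vel c t))‖ :=
  sqrt_killing_of_isHermitian (pPart_conjTranspose _)

lemma hasDerivAt_entry {c : ℝ → G n} (hc : IsC1 c) (t : ℝ) (i j : Fin n) :
    HasDerivAt (fun s => (c s : Mat n) i j) (vel c t i j) t :=
  (((hc i j).differentiable one_ne_zero) t).hasDerivAt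

lemma continuous_coe_inv {c : ℝ → G n} (hc : IsC1 c) :
    Continuous fun t => (((c t)⁻¹ : G n) : Mat n) := by
  have h1 : Continuous fun t => (c t : Mat n) := continuous_matrix fun i j => (hc i j).continuous
  simp only [Matrix.SpecialLinearGroup.coe_inv]
  exact h1.matrix_adjugate

lemma hasDerivAt_inv_entry {c : ℝ → G n} (hc : IsC1 c) {t : ℝ} (ht : c t = 1) (i j : Fin n) :
    HasDerivAt (fun s => (((c s)⁻¹ : G n) : Mat n) i j) (-vel c t i j) t := by
  rw [hasDerivAt_iff_tendsto_slope]
  have h1 : ∀ s, slope (fun s => (((c s)⁻¹ : G n) : Mat n) i j) t s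
      = -∑ k, (((c s)⁻¹ : G n) : Mat n) i k * slope (fun s => (c s : Mat n) k j) t s := by
    intro s
    -- Writing `c⁻¹ - 1 = -c⁻¹ (c - 1)` reduces differentiability of the inverse at the identity to
    -- its continuity.
    have h2 : (((c s)⁻¹ : G n) : Mat n) - 1 = - ((((c s)⁻¹ : G n) : Mat n) * ((c s : Mat n) - 1)) := by
      rw [Matrix.mul_sub, coe_inv_mul_coe, Matrix.mul_one]; abel
    have h3 := congrFun (congrFun h2 i) j
    simp only [slope_def_module, ht, inv_one, Matrix.SpecialLinearGroup.coe_one]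
    rw [Matrix.sub_apply, Matrix.neg_apply, Matrix.mul_apply] at h3
    rw [h3, smul_neg, Finset.smul_sum]
    congr 1
    refine Finset.sum_congr rfl fun k _ => ?_
    rw [Matrix.sub_apply, mul_smul_comm]
  have h4 : -vel c t i j = -∑ k, (1 : Mat n) i k * vel c t k j := by
    rw [← Matrix.mul_apply, Matrix.one_mul]
  rw [h4]
  refine Filter.Tendsto.congr (fun s => (h1 s).symm) ?_
  refine (tendsto_finsetSum _ fun k _ => ?_).neg
  refine Filter.Tendsto.mul ?_ (hasDerivAt_iff_tendsto_slope.1 (hasDerivAt_entry hc t k j))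
  have h5 : Continuous fun s => (((c s)⁻¹ : G n) : Mat n) i k :=
    (continuous_coe_inv hc).matrix_elem i k
  have h6 := h5.tendsto t
  simp only [ht, inv_one, Matrix.SpecialLinearGroup.coe_one] at h6
  exact h6.mono_left nhdsWithin_le_nhds

/-- To first order the defect of `1 + ε X` is `ε (X + Xᴴ)`, twice the `p`-component; this links the
defect to the Riemannian speed. -/
lemma hasDerivAt_defect {c : ℝ → G n} (hc : IsC1 c) (t : ℝ) :
    HasDerivAt (fun s => vecM (defect ((c t)⁻¹ * c s)))
      (vecM ((2 : ℂ) • pPart ((((c t)⁻¹ : G n) : Mat n) * vel c t))) t := by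
  set m : ℝ → G n := fun s => (c t)⁻¹ * c s with hm
  have hm1 : IsC1 m := (isC1_const _).mul hc
  have hmt : m t = 1 := by simp [hm]
  rw [← vel_mul_left _ hc]
  change HasDerivAt (fun s => vecM (defect (m s))) (vecM ((2 : ℂ) • pPart (vel m t))) t
  have h1 : HasDerivAt (fun s => fun p : Fin n × Fin n => defect (m s) p.1 p.2)
      (fun p => ((2 : ℂ) • pPart (vel m t)) p.1 p.2) t := by
    rw [hasDerivAt_pi]
    rintro ⟨i, j⟩
    have h1 := (hasDerivAt_entry hm1 t i j).sub (hasDerivAt_inv_entry hm1 hmt j i).star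
    refine h1.congr_deriv ?_
    simp only [pPart, Matrix.smul_apply, Matrix.add_apply, Matrix.conjTranspose_apply, smul_eq_mul,
      star_neg]
    ring
  exact (PiLp.hasFDerivAt_toLp (𝕜 := ℝ) 2 _).comp_hasDerivAt t h1

lemma norm_lg_sub_le_length [NeZero n] {c : ℝ → G n} (hc : IsC1 c) :
    Real.sqrt (4 * n) * ‖vecM (lg (c 1) - lg (c 0))‖ ≤ length c := by
  set κ := Real.sqrt (4 * n) with hκ
  have hκ0 : 0 ≤ κ := Real.sqrt_nonneg _
  have hdef0 : ∀ t, vecM (defect ((c t)⁻¹ * c t)) = 0 := by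
    intro t
    rw [inv_mul_cancel, defect_eq_zero (one_mem _), map_zero]
  have hL : Continuous fun t => vecM (lg (c t)) := by
    rw [continuous_iff_continuousAt]
    intro t
    rw [ContinuousAt, tendsto_iff_norm_sub_tendsto_zero]
    have h1 : Filter.Tendsto (fun s => ‖vecM (defect ((c t)⁻¹ * c s))‖) (𝓝 t) (𝓝 0) := by
      have := (hasDerivAt_defect hc t).continuousAt.norm.tendsto
      simpa only [hdef0, norm_zero] using this
    refine squeeze_zero (fun _ => norm_nonneg _) (fun s => ?_) h1
    rw [← map_sub]
    have := norm_lg_sub_le (c t) (c s)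
    linarith [norm_nonneg (vecM (lg (c s) - lg (c t)))]
  have hcont : ContinuousOn (fun t => κ * ‖vecM (lg (c t) - lg (c 0))‖) (Set.Icc 0 1) := by
    simp only [map_sub]
    exact (continuous_const.mul (hL.sub continuous_const).norm).continuousOn
  have hB : ∀ x, HasDerivAt (fun t => ∫ s in (0 : ℝ)..t, speed c s) (speed c x) x := fun x =>
    intervalIntegral.integral_hasDerivAt_right ((continuous_speed hc).intervalIntegrable _ _)
      ((continuous_speed hc).stronglyMeasurableAtFilter _ _) (continuous_speed hc).continuousAt
  -- Comparing right slopes with the speed avoids differentiating `lg`, for which only the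
  -- contraction inequality is available.
  refine image_le_of_liminf_slope_right_le_deriv_boundary
    (f := fun t => κ * ‖vecM (lg (c t) - lg (c 0))‖)
    (B := fun t => ∫ s in (0 : ℝ)..t, speed c s) (B' := speed c) hcont (by simp)
    (fun x _ => (hB x).continuousAt.continuousWithinAt) (fun x _ => (hB x).hasDerivWithinAt) ?_
    (Set.right_mem_Icc.2 zero_le_one)
  intro x _ r hr
  -- The factor `1 / 2` comes from the contraction inequality and cancels the `2` in the derivative
  -- of the defect.
  have h2 : HasDerivAt (fun s => ((κ / 2 : ℝ) : ℂ) • vecM (defect ((c x)⁻¹ * c s)))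
      (((κ / 2 : ℝ) : ℂ) • vecM ((2 : ℂ) • pPart ((((c x)⁻¹ : G n) : Mat n) * vel c x))) x :=
    (hasDerivAt_defect hc x).fun_const_smul _
  have h3 : ‖((κ / 2 : ℝ) : ℂ) • vecM ((2 : ℂ) • pPart ((((c x)⁻¹ : G n) : Mat n) * vel c x))‖ < r := by
    refine lt_of_eq_of_lt ?_ hr
    rw [speed_eq, map_smul, norm_smul, norm_smul, Complex.norm_real, Real.norm_of_nonneg
      (by positivity), Complex.norm_ofNat]
    ring
  have h4 := (h2.hasDerivWithinAt (s := Set.Ioi x)).limsup_norm_slope_le h3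
  refine Filter.Eventually.frequently ?_
  filter_upwards [h4, self_mem_nhdsWithin] with z hz hxz
  refine lt_of_le_of_lt ?_ hz
  have hzx : 0 < z - x := sub_pos.2 hxz
  rw [slope_def_module, smul_eq_mul, Real.norm_of_nonneg hzx.le]
  refine mul_le_mul_of_nonneg_left ?_ (by positivity)
  rw [hdef0, smul_zero, sub_zero, norm_smul, Complex.norm_real, Real.norm_of_nonneg (by positivity)]
  have h5 := norm_lg_sub_le (c x) (c z)
  have h6 : ‖vecM (lg (c z) - lg (c 0))‖ - ‖vecM (lg (c x) - lg (c 0))‖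
      ≤ ‖vecM (lg (c z) - lg (c x))‖ := by
    refine (norm_sub_norm_le _ _).trans_eq ?_
    rw [← map_sub]
    congr 2
    abel
  calc κ * ‖vecM (lg (c z) - lg (c 0))‖ - κ * ‖vecM (lg (c x) - lg (c 0))‖
      = κ * (‖vecM (lg (c z) - lg (c 0))‖ - ‖vecM (lg (c x) - lg (c 0))‖) := by ring
    _ ≤ κ * (‖vecM (defect ((c x)⁻¹ * c z))‖ / 2) := by
      refine mul_le_mul_of_nonneg_left ?_ hκ0
      linarith
    _ = _ := by ring

lemma le_rdist [NeZero n] (g h : G n) :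
    ENNReal.ofReal (Real.sqrt (4 * n) * ‖vecM (lg h - lg g)‖) ≤ rdist (g : Z n) (h : Z n) := by
  refine le_iInf₂ fun c hc => ?_
  obtain ⟨hc, h0, h1⟩ := hc
  rw [← lg_congr h0, ← lg_congr h1]
  exact ENNReal.ofReal_le_ofReal (norm_lg_sub_le_length hc)

lemma dexp_smul_apply (d : T n) (t : ℝ) (i j : Fin n) : (dexp (t • d) : Mat n) i j
    = if i = j then ((Real.exp (t * (d : Fin n → ℝ) i) : ℝ) : ℂ) else 0 := by
  rw [coe_dexp, Matrix.diagonal_apply]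
  rfl

lemma isC1_dexp (d : T n) : IsC1 fun t : ℝ => dexp (t • d) := by
  intro i j
  simp only [dexp_smul_apply]
  split_ifs
  · exact Complex.ofRealCLM.contDiff.comp (Real.contDiff_exp.comp (by fun_prop))
  · exact contDiff_const

lemma vel_dexp (d : T n) (t : ℝ) :
    vel (fun t : ℝ => dexp (t • d)) t = (dexp (t • d) : Mat n) * dmat d := by
  ext i j
  rw [vel, Matrix.of_apply, dmat, Matrix.mul_diagonal]
  simp only [dexp_smul_apply]
  split_ifs with h
  · subst h
    have h1 : HasDerivAt (fun s : ℝ => Real.exp (s * (d : Fin n → ℝ) i))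
        (Real.exp (t * (d : Fin n → ℝ) i) * (d : Fin n → ℝ) i) t := by
      have := ((hasDerivAt_id t).mul_const ((d : Fin n → ℝ) i)).exp
      simpa using this
    rw [h1.ofReal_comp.deriv]
    push_cast
    rfl
  · simp

lemma length_dexp (d : T n) : length (fun t : ℝ => dexp (t • d)) = dn d := by
  have : ∀ t, speed (fun t : ℝ => dexp (t • d)) t = dn d := by
    intro t
    rw [speed_eq, vel_dexp, ← Matrix.mul_assoc, coe_inv_mul_coe, Matrix.one_mul, dn]
    congr 3
    rw [pPart, dmat_conjTranspose, ← two_smul ℂ, smul_smul]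
    norm_num
  simp [length, this]

/-- The one-parameter curve gives the upper bound and the contraction property of `lg` the lower
one, so this curve is minimizing. -/
lemma rdist_dexp [NeZero n] (d : T n) :
    rdist ((1 : G n) : Z n) (dexp d : Z n) = ENNReal.ofReal (dn d) := by
  refine le_antisymm ?_ ?_
  · have h := rdist_le (isC1_dexp d)
    rw [length_dexp] at h
    simpa [dexp_zero] using h
  · have h := le_rdist (1 : G n) (dexp d)
    rwa [lg_one, lg_dexp, sub_zero] at h

lemma rdist_mul_left (g a b : G n) :
    rdist ((g * a : G n) : Z n) ((g * b : G n) : Z n) = rdist (a : Z n) (b : Z n) :=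
  rdist_smul g (a : Z n) (b : Z n)

lemma rdist_one_mul [NeZero n] {k : G n} (hk : k ∈ K n) (d : T n) :
    rdist ((1 : G n) : Z n) ((k * dexp d : G n) : Z n) = ENNReal.ofReal (dn d) := by
  have h1 : ((1 : G n) : Z n) = ((k * 1 : G n) : Z n) := by
    rw [mul_one]
    exact QuotientGroup.eq.2 (by simpa using hk)
  rw [h1, rdist_mul_left, rdist_dexp]

lemma rdist_flow [NeZero n] (g : G n) (d : T n) (s t : ℝ) :
    rdist ((g * dexp (s • d) : G n) : Z n) ((g * dexp (t • d) : G n) : Z n)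
      = ENNReal.ofReal (|t - s| * dn d) := by
  have h : t • d = s • d + (t - s) • d := by rw [← add_smul]; congr 1; ring
  rw [rdist_mul_left, h, dexp_add]
  conv_lhs => rw [← mul_one (dexp (s • d))]
  rw [mul_assoc, rdist_mul_left, one_mul, rdist_dexp, dn_smul]

/-- If `w = k⁻¹ l` intertwines the diagonal matrices `a` and `b`, then `w i j ≠ 0` forces `a i = b
j`; hence `w` intertwines their exponentials too. -/
lemma conj_dexp_congr {k l : G n} (hk : k ∈ K n) (hl : l ∈ K n) {a b : T n}
    (h : (k : Mat n) * dmat a * (k : Mat n)ᴴ = (l : Mat n) * dmat b * (l : Mat n)ᴴ) :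
    k * dexp a * k⁻¹ = l * dexp b * l⁻¹ := by
  set w : G n := k⁻¹ * l with hw
  have hwc : (w : Mat n) = (k : Mat n)ᴴ * (l : Mat n) := by
    rw [hw, Matrix.SpecialLinearGroup.coe_mul, coe_inv_of_mem_K hk]
  have h1 : dmat a * (w : Mat n) = (w : Mat n) * dmat b := by
    calc dmat a * (w : Mat n)
        = ((k : Mat n)ᴴ * (k : Mat n)) * dmat a * ((k : Mat n)ᴴ * (l : Mat n)) := by
          rw [mem_K_iff'.1 hk, Matrix.one_mul, hwc]
      _ = (k : Mat n)ᴴ * ((k : Mat n) * dmat a * (k : Mat n)ᴴ) * (l : Mat n) := by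
          simp only [Matrix.mul_assoc]
      _ = (k : Mat n)ᴴ * (l : Mat n) * dmat b * ((l : Mat n)ᴴ * (l : Mat n)) := by
          rw [h]; simp only [Matrix.mul_assoc]
      _ = (w : Mat n) * dmat b := by
          rw [mem_K_iff'.1 hl, Matrix.mul_one, hwc]
  have h2 : dexp a * w = w * dexp b := by
    apply Subtype.ext
    change (dexp a : Mat n) * (w : Mat n) = (w : Mat n) * (dexp b : Mat n)
    ext i j
    have h3 := congrFun (congrFun h1 i) j
    rw [dmat, dmat, Matrix.diagonal_mul, Matrix.mul_diagonal, mul_comm] at h3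
    rw [coe_dexp, coe_dexp, Matrix.diagonal_mul, Matrix.mul_diagonal, mul_comm]
    rcases eq_or_ne ((w : Mat n) i j) 0 with h0 | h0
    · rw [h0, zero_mul, zero_mul]
    · have h4 : (a : Fin n → ℝ) i = (b : Fin n → ℝ) j := by
        exact_mod_cast mul_left_cancel₀ h0 h3
      rw [h4]
  have h3 : dexp a = w * dexp b * w⁻¹ := by rw [← h2]; group
  rw [h3, hw]; group

lemma mk_mul_of_mem {k : G n} (hk : k ∈ K n) (g : G n) : ((g * k : G n) : Z n) = (g : Z n) :=
  QuotientGroup.mk_mul_of_mem _ hk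

lemma mk_mul_left {a b : G n} (h : (a : Z n) = b) (g : G n) :
    ((g * a : G n) : Z n) = ((g * b : G n) : Z n) :=
  congrArg (fun z : Z n => g • z) h

/-- The class of `g` is that of `k exp(d) k⁻¹`, which is the exponential of `lg g`. -/
lemma mk_eq_of_lg_eq [NeZero n] {g h : G n} (e : lg g = lg h) : (g : Z n) = h := by
  obtain ⟨k, hk, d, l, hl, hg, eg⟩ := exists_lg_eq g
  obtain ⟨k', hk', d', l', hl', hh, eh⟩ := exists_lg_eq h
  have h1 := conj_dexp_congr hk hk' (eg.symm.trans (e.trans eh))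
  have h2 : ((g : G n) : Z n) = ((k * dexp d * k⁻¹ : G n) : Z n) := by
    rw [mk_mul_of_mem (inv_mem hk), hg, mk_mul_of_mem hl]
  have h3 : ((h : G n) : Z n) = ((k' * dexp d' * k'⁻¹ : G n) : Z n) := by
    rw [mk_mul_of_mem (inv_mem hk'), hh, mk_mul_of_mem hl']
  rw [h2, h3, h1]

lemma rdist_one_eq_norm_lg [NeZero n] (g : G n) :
    rdist ((1 : G n) : Z n) (g : Z n) = ENNReal.ofReal (Real.sqrt (4 * n) * ‖vecM (lg g)‖) := by
  obtain ⟨k, hk, d, l, hl, hg, eg⟩ := exists_lg_eq g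
  rw [eg, norm_vecM_unitary (mem_K_iff'.1 hk) (by simpa using mem_K_iff'.1 hk), hg,
    mk_mul_of_mem hl, rdist_one_mul hk, dn]

/-! ### Geodesics are orbits of one-parameter groups -/

/-- Two geodesics that agree at two times agree. -/
lemma flow_unique [NeZero n] {g g' : G n} {d d' : T n} {s t : ℝ} (hst : s ≠ t)
    (hs : ((g * dexp (s • d) : G n) : Z n) = ((g' * dexp (s • d') : G n) : Z n))
    (ht : ((g * dexp (t • d) : G n) : Z n) = ((g' * dexp (t • d') : G n) : Z n)) (r : ℝ) :
    ((g * dexp (r • d) : G n) : Z n) = ((g' * dexp (r • d') : G n) : Z n) := by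
  set h := g * dexp (s • d) with hh
  set h' := g' * dexp (s • d') with hh'
  set k := h⁻¹ * h' with hk
  have hkK : k ∈ K n := QuotientGroup.eq.1 hs
  have e : ∀ r, g * dexp (r • d) = h * dexp ((r - s) • d) := by
    intro r
    rw [hh, mul_assoc, ← dexp_add, ← add_smul, add_sub_cancel]
  have e' : ∀ r, g' * dexp (r • d') = h * (k * dexp ((r - s) • d')) := by
    intro r
    have : h * (k * dexp ((r - s) • d')) = h' * dexp ((r - s) • d') := by rw [hk]; group
    rw [this, hh', mul_assoc, ← dexp_add, ← add_smul, add_sub_cancel]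
  rw [e, e'] at ht
  have ht2 : ((dexp ((t - s) • d) : G n) : Z n) = ((k * dexp ((t - s) • d') : G n) : Z n) := by
    have := mk_mul_left ht h⁻¹
    simpa using this
  have h1 := lg_congr ht2
  -- Once the common point at time `s` is moved to `u`, `lg` turns both geodesics into lines through
  -- `0`; one further common time determines the direction.
  rw [lg_dexp, lg_frame hkK, dmat_smul, dmat_smul, Matrix.mul_smul, Matrix.smul_mul] at h1
  have hts : ((t - s : ℝ) : ℂ) ≠ 0 := by
    exact_mod_cast sub_ne_zero.2 hst.symm
  have h2 : dmat d = (k : Mat n) * dmat d' * (k : Mat n)ᴴ := smul_right_injective _ hts h1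
  have h3 := conj_dexp_congr (one_mem (K n)) hkK (a := (r - s) • d) (b := (r - s) • d') (by
    rw [dmat_smul, dmat_smul, Matrix.mul_smul, Matrix.smul_mul, Matrix.mul_smul, Matrix.smul_mul,
      ← h2]
    simp)
  rw [one_mul, inv_one, mul_one] at h3
  rw [e, e', h3, ← mul_assoc, mk_mul_of_mem (inv_mem hkK)]

/-- A distance preserving curve on a segment is the orbit of a one-parameter group. -/
lemma exists_flow_of_isometry [NeZero n] {γ : ℝ → Z n} {a b : ℝ} (hab : a < b)
    (h : ∀ x ∈ Set.Icc a b, ∀ y ∈ Set.Icc a b, rdist (γ x) (γ y) = edist x y) :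
    ∃ (g : G n) (d : T n), dn d = 1 ∧
      ∀ t ∈ Set.Icc a b, γ t = ((g * dexp (t • d) : G n) : Z n) := by
  obtain ⟨g₀, hg₀⟩ := QuotientGroup.mk_surjective (γ a)
  choose q hq using fun t => QuotientGroup.mk_surjective (γ t)
  set p : ℝ → G n := fun t => g₀⁻¹ * q t with hp
  have hγ : ∀ t, γ t = ((g₀ * p t : G n) : Z n) := by
    intro t
    rw [hp, ← hq t, mul_inv_cancel_left]
  have ha : a ∈ Set.Icc a b := Set.left_mem_Icc.2 hab.le
  have hb : b ∈ Set.Icc a b := Set.right_mem_Icc.2 hab.le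
  set κ := Real.sqrt (4 * n) with hκ
  have hκ0 : 0 < κ := Real.sqrt_pos.2 (by have := NeZero.pos n; positivity)
  have h1 : ∀ t ∈ Set.Icc a b, κ * ‖vecM (lg (p t))‖ = t - a := by
    intro t ht
    have e := h a ha t ht
    rw [← hg₀, hγ t] at e
    have e2 : rdist (g₀ : Z n) ((g₀ * p t : G n) : Z n) = rdist ((1 : G n) : Z n) (p t : Z n) := by
      rw [← rdist_mul_left g₀ 1, mul_one]
    rw [e2, rdist_one_eq_norm_lg, edist_dist, dist_comm, Real.dist_eq,
      abs_of_nonneg (sub_nonneg.2 ht.1)] at e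
    exact (ENNReal.ofReal_eq_ofReal_iff (by positivity) (sub_nonneg.2 ht.1)).1 e
  have h2 : ∀ t ∈ Set.Icc a b, κ * ‖vecM (lg (p b)) - vecM (lg (p t))‖ ≤ b - t := by
    intro t ht
    have e := h t ht b hb
    rw [hγ t, hγ b, rdist_mul_left, edist_dist, dist_comm, Real.dist_eq,
      abs_of_nonneg (sub_nonneg.2 ht.2)] at e
    have e2 := le_rdist (p t) (p b)
    rw [e, map_sub] at e2
    exact (ENNReal.ofReal_le_ofReal_iff (sub_nonneg.2 ht.2)).1 e2
  obtain ⟨k, hk, d, l, hl, hpb, eb⟩ := exists_lg_eq (p b)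
  have hba : 0 < b - a := sub_pos.2 hab
  set δ : T n := (b - a)⁻¹ • d with hδ
  have hdn : dn δ = 1 := by
    have e := h1 b hb
    rw [eb, norm_vecM_unitary (mem_K_iff'.1 hk) (by simpa using mem_K_iff'.1 hk)] at e
    rw [hδ, dn_smul, dn, e, abs_of_pos (inv_pos.2 hba), inv_mul_cancel₀ hba.ne']
  -- The factor `dexp (-(a • δ))` shifts time so that the flow starts at `γ a` when `t = a`.
  refine ⟨g₀ * k * dexp (-(a • δ)), δ, hdn, fun t ht => ?_⟩
  set r := (t - a) / (b - a) with hr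
  have hdist0 : dist (0 : EuclideanSpace ℂ (Fin n × Fin n)) (vecM (lg (p t)))
      = r * dist (0 : EuclideanSpace ℂ (Fin n × Fin n)) (vecM (lg (p b))) := by
    rw [dist_zero_left, dist_zero_left]
    have e1 := h1 t ht
    have e2 := h1 b hb
    have : κ * ‖vecM (lg (p t))‖ = κ * (r * ‖vecM (lg (p b))‖) := by
      rw [e1, mul_left_comm, e2, hr, div_mul_cancel₀ _ hba.ne']
    exact mul_left_cancel₀ hκ0.ne' this
  have hdist1 : dist (vecM (lg (p t))) (vecM (lg (p b)))
      = (1 - r) * dist (0 : EuclideanSpace ℂ (Fin n × Fin n)) (vecM (lg (p b))) := by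
    refine le_antisymm ?_ ?_
    · rw [dist_zero_left, dist_comm, dist_eq_norm]
      have e1 := h2 t ht
      have e2 := h1 b hb
      have : κ * ‖vecM (lg (p b)) - vecM (lg (p t))‖ ≤ κ * ((1 - r) * ‖vecM (lg (p b))‖) := by
        refine e1.trans_eq ?_
        rw [mul_left_comm, e2, hr]
        field_simp
        ring
      exact le_of_mul_le_mul_left this hκ0
    · have := dist_triangle (0 : EuclideanSpace ℂ (Fin n × Fin n)) (vecM (lg (p t)))
        (vecM (lg (p b)))
      linarith
  -- The contraction property and the triangle inequality make the two distances add up exactly, so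
  -- strict convexity puts `lg (p t)` on the segment from `0` to `lg (p b)`.
  have hline := eq_lineMap_of_dist_eq_mul_of_dist_eq_mul hdist0 hdist1
  rw [AffineMap.lineMap_apply_module, smul_zero, zero_add] at hline
  have hlg : lg (p t) = lg (k * dexp (r • d)) := by
    apply vecM_injective
    rw [hline, eb, lg_frame hk, dmat_smul, Matrix.mul_smul, Matrix.smul_mul, map_smul]
    rfl
  rw [hγ t, mk_mul_left (mk_eq_of_lg_eq hlg) g₀]
  congr 1
  have : r • d = -(a • δ) + t • δ := by
    rw [hδ, smul_smul, smul_smul, ← neg_smul, ← add_smul, hr]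
    congr 1
    field_simp
    ring
  rw [this, dexp_add]
  group

/-- A locally distance preserving curve on a segment is the orbit of a one-parameter group. -/
lemma exists_flow_Icc [NeZero n] {γ : ℝ → Z n} {a b : ℝ} (hab : a < b)
    (h : ∀ t ∈ Set.Icc a b, ∃ ε > 0, ∀ x ∈ Set.Icc a b, ∀ y ∈ Set.Icc a b, dist x t < ε →
      dist y t < ε → rdist (γ x) (γ y) = edist x y) :
    ∃ (g : G n) (d : T n), dn d = 1 ∧
      ∀ t ∈ Set.Icc a b, γ t = ((g * dexp (t • d) : G n) : Z n) := by
  have h' : ∀ t : Set.Icc a b, ∃ ε > 0, ∀ x ∈ Set.Icc a b, ∀ y ∈ Set.Icc a b, dist x t < ε →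
      dist y t < ε → rdist (γ x) (γ y) = edist x y := fun t => h t t.2
  choose ε hε hiso using h'
  obtain ⟨δ, hδ, hcov⟩ := lebesgue_number_lemma_of_metric (s := Set.Icc a b)
    (c := fun t : Set.Icc a b => Metric.ball (t : ℝ) (ε t)) isCompact_Icc
    (fun _ => Metric.isOpen_ball)
    (fun t ht => Set.mem_iUnion.2 ⟨⟨t, ht⟩, Metric.mem_ball_self (hε _)⟩)
  have hunif : ∀ x ∈ Set.Icc a b, ∀ y ∈ Set.Icc a b, dist y x < δ →
      rdist (γ x) (γ y) = edist x y := by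
    intro x hx y hy hxy
    obtain ⟨i, hi⟩ := hcov x hx
    exact hiso i x hx y hy (hi (Metric.mem_ball_self hδ)) (hi hxy)
  -- Segments of length `2 * η < δ` are embedded isometrically, and consecutive ones overlap in
  -- length `η`, which gives the two common points that `flow_unique` needs.
  set η := δ / 3 with hη
  have hη0 : 0 < η := by positivity
  have hseg : ∀ a' b', a ≤ a' → b' ≤ b → a' < b' → b' - a' ≤ 2 * η →
      ∃ (g : G n) (d : T n), dn d = 1 ∧
        ∀ t ∈ Set.Icc a' b', γ t = ((g * dexp (t • d) : G n) : Z n) := by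
    intro a' b' ha hb hab' hlen
    refine exists_flow_of_isometry hab' fun x hx y hy => ?_
    refine hunif x ⟨ha.trans hx.1, hx.2.trans hb⟩ y ⟨ha.trans hy.1, hy.2.trans hb⟩ ?_
    rw [Real.dist_eq, abs_lt]
    constructor <;> linarith [hx.1, hx.2, hy.1, hy.2]
  have hind : ∀ k : ℕ, ∃ (g : G n) (d : T n), dn d = 1 ∧
      ∀ t ∈ Set.Icc a b, t ≤ a + (k + 1) * η → γ t = ((g * dexp (t • d) : G n) : Z n) := by
    intro k
    induction k with
    | zero =>
      obtain ⟨g, d, hd, hg⟩ := hseg a (min b (a + η)) le_rfl (min_le_left _ _)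
        (lt_min hab (by linarith)) (by linarith [min_le_right b (a + η)])
      refine ⟨g, d, hd, fun t ht htk => hg t ⟨ht.1, le_min ht.2 ?_⟩⟩
      simpa using htk
    | succ k ih =>
      obtain ⟨g, d, hd, hg⟩ := ih
      rcases le_or_gt b (a + (k + 1) * η) with hbk | hbk
      · exact ⟨g, d, hd, fun t ht _ => hg t ht (ht.2.trans hbk)⟩
      have hk0 : 0 ≤ (k : ℝ) * η := by positivity
      obtain ⟨g', d', hd', hg'⟩ := hseg (a + k * η) (min b (a + (k + 2) * η)) (by linarith)
        (min_le_left _ _) (lt_min (by linarith) (by linarith))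
        (by linarith [min_le_right b (a + (k + 2) * η)])
      refine ⟨g, d, hd, fun t ht htk => ?_⟩
      rcases le_or_gt t (a + (k + 1) * η) with h1 | h1
      · exact hg t ht h1
      push_cast at htk
      rw [hg' t ⟨by linarith, le_min ht.2 (by linarith)⟩]
      refine flow_unique (s := a + k * η) (t := a + (k + 1) * η) (by linarith) ?_ ?_ t
      · rw [← hg' _ ⟨le_rfl, le_min (by linarith) (by linarith)⟩,
          ← hg _ ⟨by linarith, by linarith⟩ (by linarith)]
      · rw [← hg' _ ⟨by linarith, le_min (by linarith) (by linarith)⟩,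
          ← hg _ ⟨by linarith, by linarith⟩ (by linarith)]
  obtain ⟨k, hk⟩ := exists_nat_gt ((b - a) / η)
  obtain ⟨g, d, hd, hg⟩ := hind k
  refine ⟨g, d, hd, fun t ht => hg t ht ?_⟩
  rw [div_lt_iff₀ hη0] at hk
  linarith [ht.2]

/-- A locally distance preserving curve on an interval is the orbit of a one-parameter group. -/
lemma exists_flow [NeZero n] {γ : ℝ → Z n} {s : Set ℝ} (hs : s.OrdConnected)
    (h0 : (0 : ℝ) ∈ s) (h1 : (1 : ℝ) ∈ s)
    (h : ∀ t ∈ s, ∃ ε > 0, ∀ x ∈ s, ∀ y ∈ s, dist x t < ε →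
      dist y t < ε → rdist (γ x) (γ y) = edist x y) :
    ∃ (g : G n) (d : T n), dn d = 1 ∧ ∀ t ∈ s, γ t = ((g * dexp (t • d) : G n) : Z n) := by
  have hsub : ∀ a ∈ s, ∀ b ∈ s, a < b → ∃ (g : G n) (d : T n), dn d = 1 ∧
      ∀ t ∈ Set.Icc a b, γ t = ((g * dexp (t • d) : G n) : Z n) := by
    intro a ha b hb hab
    have hss : Set.Icc a b ⊆ s := hs.out ha hb
    refine exists_flow_Icc hab fun t ht => ?_
    obtain ⟨ε, hε, hiso⟩ := h t (hss ht)
    exact ⟨ε, hε, fun x hx y hy => hiso x (hss hx) y (hss hy)⟩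
  obtain ⟨g, d, hd, hg⟩ := hsub 0 h0 1 h1 one_pos
  refine ⟨g, d, hd, fun t ht => ?_⟩
  have hmin : min t 0 ∈ s := by rcases min_choice t 0 with e | e <;> rwa [e]
  have hmax : max t 1 ∈ s := by rcases max_choice t 1 with e | e <;> rwa [e]
  have hl0 : min t 0 ≤ 0 := min_le_right _ _
  have hr1 : 1 ≤ max t 1 := le_max_right _ _
  -- The flow is fixed once on `[0, 1]`; a segment containing both `[0, 1]` and `t` must follow the
  -- same flow.
  obtain ⟨g', d', hd', hg'⟩ := hsub _ hmin _ hmax (by linarith)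
  rw [hg' t ⟨min_le_left _ _, le_max_left _ _⟩]
  refine flow_unique (zero_ne_one (α := ℝ)) ?_ ?_ t
  · rw [← hg' 0 ⟨hl0, by linarith⟩, hg 0 ⟨le_rfl, zero_le_one⟩]
  · rw [← hg' 1 ⟨by linarith, hr1⟩, hg 1 ⟨zero_le_one, le_rfl⟩]

lemma Ray.exists_flow [NeZero n] (γ : Ray n) : ∃ (g : G n) (d : T n), dn d = 1 ∧
    ∀ t : ℝ≥0, γ.toFun t = ((g * dexp ((t : ℝ) • d) : G n) : Z n) := by
  obtain ⟨g, d, hd, hg⟩ := SymSpace.exists_flow (γ := fun t => γ.toFun t.toNNReal)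
    (s := Set.Ici 0) Set.ordConnected_Ici Set.self_mem_Ici (Set.mem_Ici.2 zero_le_one) (by
      intro t ht
      obtain ⟨U, hU, hiso⟩ := γ.isGeodesic t.toNNReal
      obtain ⟨ε, hε, hball⟩ := Metric.mem_nhds_iff.1 hU
      have hmem : ∀ x : ℝ, 0 ≤ x → dist x t < ε → x.toNNReal ∈ U := by
        intro x hx hxt
        refine hball ?_
        rw [Metric.mem_ball, NNReal.dist_eq, Real.coe_toNNReal x hx, Real.coe_toNNReal t ht]
        exact hxt
      refine ⟨ε, hε, fun x hx y hy hxt hyt => ?_⟩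
      rw [hiso _ (hmem x hx hxt) _ (hmem y hy hyt), edist_dist, edist_dist, NNReal.dist_eq,
        Real.coe_toNNReal x hx, Real.coe_toNNReal y hy, Real.dist_eq])
  refine ⟨g, d, hd, fun t => ?_⟩
  have := hg t t.2
  rwa [Real.toNNReal_coe] at this

lemma GeodesicLine.exists_flow [NeZero n] (γ : GeodesicLine n) : ∃ (g : G n) (d : T n), dn d = 1 ∧
    ∀ t : ℝ, γ.toFun t = ((g * dexp (t • d) : G n) : Z n) := by
  obtain ⟨g, d, hd, hg⟩ := SymSpace.exists_flow (γ := γ.toFun) (s := Set.univ)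
    Set.ordConnected_univ trivial trivial (by
      intro t _
      obtain ⟨U, hU, hiso⟩ := γ.isGeodesic t
      obtain ⟨ε, hε, hball⟩ := Metric.mem_nhds_iff.1 hU
      exact ⟨ε, hε, fun x _ y _ hxt hyt => hiso x (hball hxt) y (hball hyt)⟩)
  exact ⟨g, d, hd, fun t => hg t trivial⟩

/-! ### Bounded distance, bounded entries and asymptotic rays -/

lemma abs_apply_le_dn [NeZero n] (d : T n) (i : Fin n) : |(d : Fin n → ℝ) i| ≤ dn d := by
  refine abs_le_of_sq_le_sq' ?_ (dn_nonneg d) |> abs_le.2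
  rw [dn_sq]
  have h1 : (d : Fin n → ℝ) i ^ 2 ≤ ∑ i, (d : Fin n → ℝ) i ^ 2 :=
    Finset.single_le_sum (f := fun i => (d : Fin n → ℝ) i ^ 2) (fun _ _ => sq_nonneg _)
      (Finset.mem_univ i)
  have h2 : (1 : ℝ) ≤ n := by exact_mod_cast NeZero.pos n
  nlinarith [sq_nonneg ((d : Fin n → ℝ) i)]

lemma norm_entry_le_of_rdist_le [NeZero n] {g : G n} {C : ℝ≥0}
    (h : rdist ((1 : G n) : Z n) (g : Z n) ≤ C) (i j : Fin n) :
    ‖(g : Mat n) i j‖ ≤ n * Real.exp C := by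
  obtain ⟨k, hk, d, l, hl, rfl⟩ := exists_cartan g
  rw [mk_mul_of_mem hl, rdist_one_mul hk, ENNReal.ofReal_le_coe] at h
  have hd : dn d ≤ C := h
  rw [Matrix.SpecialLinearGroup.coe_mul, Matrix.SpecialLinearGroup.coe_mul, Matrix.mul_apply]
  calc ‖∑ m, ((k : Mat n) * (dexp d : Mat n)) i m * (l : Mat n) m j‖
      ≤ ∑ _m : Fin n, Real.exp C := by
        refine norm_sum_le_of_le _ fun m _ => ?_
        rw [coe_dexp, Matrix.mul_diagonal, norm_mul, norm_mul, Complex.norm_real,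
          Real.norm_of_nonneg (Real.exp_nonneg _)]
        have h1 := entry_norm_bound_of_unitary hk i m
        have h2 := entry_norm_bound_of_unitary hl m j
        have h3 : Real.exp ((d : Fin n → ℝ) m) ≤ Real.exp C :=
          Real.exp_le_exp.2 ((le_abs_self _).trans ((abs_apply_le_dn d m).trans hd))
        calc _ ≤ 1 * Real.exp C * 1 := by gcongr
          _ = _ := by ring
    _ = n * Real.exp C := by simp

/-- Bounded entries bound the Cartan exponents from above, and trace zero turns this into a bound
from below. -/
lemma exists_rdist_le_of_norm_entry_le [NeZero n] (C : ℝ) : ∃ C' : ℝ≥0, ∀ g : G n,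
    (∀ i j, ‖(g : Mat n) i j‖ ≤ C) → rdist ((1 : G n) : Z n) (g : Z n) ≤ C' := by
  set M : ℝ := Real.log (1 + n * (n * |C|)) with hM
  have hM0 : 0 ≤ M := Real.log_nonneg (by linarith [show 0 ≤ n * (n * |C|) by positivity])
  refine ⟨(Real.sqrt (4 * n * ∑ _i : Fin n, (n * M) ^ 2)).toNNReal, fun g hg => ?_⟩
  obtain ⟨k, hk, d, l, hl, hkl⟩ := exists_cartan g
  rw [hkl, mk_mul_of_mem hl, rdist_one_mul hk]
  refine ENNReal.ofReal_le_ofReal (Real.le_sqrt_of_sq_le ?_)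
  rw [dn_sq]
  have hup : ∀ i, (d : Fin n → ℝ) i ≤ M := by
    intro i
    rw [hM, Real.le_log_iff_exp_le (by positivity)]
    have h1 : dexp d = k⁻¹ * g * l⁻¹ := by rw [hkl]; group
    have h2 : (dexp d : Mat n) i i = (((k⁻¹ * g * l⁻¹ : G n)) : Mat n) i i := by rw [h1]
    rw [coe_dexp, Matrix.diagonal_apply_eq, Matrix.SpecialLinearGroup.coe_mul,
      Matrix.SpecialLinearGroup.coe_mul, Matrix.mul_apply] at h2
    have h3 := congrArg norm h2
    rw [Complex.norm_real, Real.norm_of_nonneg (Real.exp_nonneg _)] at h3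
    rw [h3]
    calc ‖∑ m, (((k⁻¹ : G n) : Mat n) * (g : Mat n)) i m * ((l⁻¹ : G n) : Mat n) m i‖
        ≤ ∑ _m : Fin n, (n * |C|) := by
          refine norm_sum_le_of_le _ fun m _ => ?_
          rw [norm_mul, Matrix.mul_apply]
          have h4 : ‖∑ p, ((k⁻¹ : G n) : Mat n) i p * (g : Mat n) p m‖ ≤ ∑ _p : Fin n, |C| := by
            refine norm_sum_le_of_le _ fun p _ => ?_
            rw [norm_mul]
            calc _ ≤ 1 * |C| := by
                  gcongr
                  · exact entry_norm_bound_of_unitary ((K n).inv_mem hk) i p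
                  · exact (hg p m).trans (le_abs_self C)
              _ = |C| := one_mul _
          rw [Finset.sum_const, Finset.card_univ, Fintype.card_fin, nsmul_eq_mul] at h4
          calc _ ≤ n * |C| * 1 := by
                gcongr
                exact entry_norm_bound_of_unitary ((K n).inv_mem hl) m i
            _ = _ := mul_one _
      _ = n * (n * |C|) := by simp
      _ ≤ _ := by linarith
  have habs : ∀ i, |(d : Fin n → ℝ) i| ≤ n * M := by
    intro i
    have hn1 : (1 : ℝ) ≤ n := by exact_mod_cast NeZero.pos n
    rw [abs_le]
    constructor
    -- The exponent `d i` is minus the sum of the others, each at most `M`.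
    · have h1 := T.sum_eq_zero d
      rw [← Finset.add_sum_erase _ _ (Finset.mem_univ i)] at h1
      have h2 : ∑ j ∈ Finset.univ.erase i, (d : Fin n → ℝ) j ≤ ∑ _j : Fin n, M :=
        (Finset.sum_le_sum fun j _ => hup j).trans
          (Finset.sum_le_sum_of_subset_of_nonneg (Finset.erase_subset _ _) fun _ _ _ => hM0)
      rw [Finset.sum_const, Finset.card_univ, Fintype.card_fin, nsmul_eq_mul] at h2
      linarith
    · nlinarith [hup i]
  refine mul_le_mul_of_nonneg_left (Finset.sum_le_sum fun i _ => ?_) (by positivity)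
  exact sq_le_sq' (abs_le.1 (habs i)).1 (abs_le.1 (habs i)).2

/-- The ray `t ↦ g exp(t d) u`. -/
noncomputable def rayOf [NeZero n] (g : G n) (d : T n) (hd : dn d = 1) : Ray n where
  toFun t := ((g * dexp ((t : ℝ) • d) : G n) : Z n)
  isGeodesic := by
    refine fun t => ⟨Set.univ, Filter.univ_mem, fun a _ b _ => ?_⟩
    rw [rdist_flow, hd, mul_one, edist_dist, dist_comm, NNReal.dist_eq]

/-- The geodesic `t ↦ g exp(t d) u`. -/
noncomputable def lineOf [NeZero n] (g : G n) (d : T n) (hd : dn d = 1) : GeodesicLine n where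
  toFun t := ((g * dexp (t • d) : G n) : Z n)
  isGeodesic := by
    refine fun t => ⟨Set.univ, Filter.univ_mem, fun a _ b _ => ?_⟩
    rw [rdist_flow, hd, mul_one, edist_dist, dist_comm, Real.dist_eq]

/-- The boundary point of the ray `t ↦ g exp(t d) u`. -/
noncomputable def bpt [NeZero n] (g : G n) (d : T n) (hd : dn d = 1) : Boundary n :=
  Quotient.mk _ (rayOf g d hd)

lemma Ray.ext_toFun {r s : Ray n} (h : ∀ t, r.toFun t = s.toFun t) : r = s := by
  cases r; cases s
  congr
  exact funext h

lemma GeodesicLine.ext_toFun {r s : GeodesicLine n} (h : ∀ t, r.toFun t = s.toFun t) : r = s := by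
  cases r; cases s
  congr
  exact funext h

lemma exists_eq_bpt [NeZero n] (z : Boundary n) : ∃ g d hd, z = bpt g d hd := by
  induction z using Quotient.inductionOn with
  | h γ =>
    obtain ⟨g, d, hd, hg⟩ := γ.exists_flow
    exact ⟨g, d, hd, congrArg (Quotient.mk _) (Ray.ext_toFun hg)⟩

lemma smul_bpt [NeZero n] (h g : G n) (d : T n) (hd : dn d = 1) :
    h • bpt g d hd = bpt (h * g) d hd := by
  change (Quotient.mk _ (Ray.translate h (rayOf g d hd)) : Boundary n) = _
  refine congrArg (Quotient.mk _) (Ray.ext_toFun fun t => ?_)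
  change h • ((g * dexp ((t : ℝ) • d) : G n) : Z n) = ((h * g * dexp ((t : ℝ) • d) : G n) : Z n)
  rw [mul_assoc]
  rfl

lemma dn_neg (d : T n) : dn (-d) = dn d := by
  rw [← neg_one_smul ℝ d, dn_smul]; simp

lemma posRay_lineOf [NeZero n] (g : G n) (d : T n) (hd : dn d = 1) :
    (Quotient.mk _ (lineOf g d hd).posRay : Boundary n) = bpt g d hd := rfl

lemma negRay_lineOf [NeZero n] (g : G n) (d : T n) (hd : dn d = 1) :
    (Quotient.mk _ (lineOf g d hd).negRay : Boundary n)
      = bpt g (-d) ((dn_neg d).trans hd) := by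
  refine congrArg (Quotient.mk _) (Ray.ext_toFun fun t => ?_)
  change ((g * dexp ((-(t : ℝ)) • d) : G n) : Z n) = ((g * dexp ((t : ℝ) • -d) : G n) : Z n)
  rw [smul_neg, ← neg_smul]

lemma exists_eq_lineOf [NeZero n] (γ : GeodesicLine n) : ∃ g d hd, γ = lineOf g d hd := by
  obtain ⟨g, d, hd, hg⟩ := γ.exists_flow
  refine ⟨g, d, hd, ?_⟩
  exact GeodesicLine.ext_toFun hg

/-- Moving the first ray to `u` leaves `exp(-t d) g⁻¹ g' exp(t d')`, whose entries are those of `g⁻¹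
g'` times `e^{t (d' j - d i)}`; boundedness for `t ≥ 0` excludes exactly the growing ones. -/
lemma bpt_eq_iff [NeZero n] {g g' : G n} {d d' : T n} {hd : dn d = 1} {hd' : dn d' = 1} :
    bpt g d hd = bpt g' d' hd' ↔
      ∀ i j, (d : Fin n → ℝ) i < (d' : Fin n → ℝ) j → ((g⁻¹ * g' : G n) : Mat n) i j = 0 := by
  refine Quotient.eq.trans ?_
  change (∃ C : ℝ≥0, ∀ t : ℝ≥0, rdist ((g * dexp ((t : ℝ) • d) : G n) : Z n)
    ((g' * dexp ((t : ℝ) • d') : G n) : Z n) ≤ C) ↔ _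
  set h : G n := g⁻¹ * g' with hh
  set p : ℝ → G n := fun t => dexp (t • -d) * h * dexp (t • d') with hp
  have hr : ∀ t : ℝ, rdist ((g * dexp (t • d) : G n) : Z n) ((g' * dexp (t • d') : G n) : Z n)
      = rdist ((1 : G n) : Z n) (p t : Z n) := by
    intro t
    rw [← rdist_mul_left (g * dexp (t • d)) 1 (p t), mul_one]
    congr 2
    change _ = g * dexp (t • d) * (dexp (t • -d) * h * dexp (t • d'))
    rw [smul_neg, dexp_neg, hh]
    group
  have hent : ∀ (t : ℝ) i j, ‖(p t : Mat n) i j‖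
      = ‖(h : Mat n) i j‖ * Real.exp (t * ((d' : Fin n → ℝ) j - (d : Fin n → ℝ) i)) := by
    intro t i j
    rw [hp, Matrix.SpecialLinearGroup.coe_mul, Matrix.SpecialLinearGroup.coe_mul, coe_dexp,
      coe_dexp, Matrix.mul_diagonal, Matrix.diagonal_mul, norm_mul, norm_mul, Complex.norm_real,
      Complex.norm_real, Real.norm_of_nonneg (Real.exp_nonneg _),
      Real.norm_of_nonneg (Real.exp_nonneg _), mul_comm (Real.exp _), mul_assoc, ← Real.exp_add]
    congr 2
    simp only [Submodule.coe_smul, Submodule.coe_neg, Pi.smul_apply, Pi.neg_apply, smul_eq_mul]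
    ring
  simp only [hr]
  constructor
  · rintro ⟨C, hC⟩ i j hij
    by_contra h0
    set ε := (d' : Fin n → ℝ) j - (d : Fin n → ℝ) i with hε
    have hε0 : 0 < ε := sub_pos.2 hij
    have hpos : 0 < ‖(h : Mat n) i j‖ := norm_pos_iff.2 h0
    set B := n * Real.exp C with hB
    -- At this time the linear lower bound `1 + t ε` for the exponential already pushes the entry
    -- above `B`.
    set t : ℝ := B / (‖(h : Mat n) i j‖ * ε) with ht
    have ht0 : 0 ≤ t := by positivity
    have h1 := norm_entry_le_of_rdist_le (hC ⟨t, ht0⟩) i j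
    rw [hent] at h1
    have h2 := Real.add_one_le_exp (t * ε)
    have h3 : ‖(h : Mat n) i j‖ * (t * ε) = B := by
      rw [ht]; field_simp
    have h4 : ‖(h : Mat n) i j‖ * (t * ε + 1) ≤ B :=
      (mul_le_mul_of_nonneg_left h2 hpos.le).trans h1
    linarith
  · intro h0
    obtain ⟨C', hC'⟩ := exists_rdist_le_of_norm_entry_le (n := n) ‖vecM (h : Mat n)‖
    refine ⟨C', fun t => hC' _ fun i j => ?_⟩
    rw [hent]
    rcases lt_or_ge ((d : Fin n → ℝ) i) ((d' : Fin n → ℝ) j) with hlt | hge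
    · rw [h0 i j hlt]; simp
    · have h1 : ‖(h : Mat n) i j‖ ≤ ‖vecM (h : Mat n)‖ := by
        have := PiLp.norm_apply_le (vecM (h : Mat n)) (i, j)
        simpa using this
      have h2 : Real.exp (t * ((d' : Fin n → ℝ) j - (d : Fin n → ℝ) i)) ≤ 1 :=
        Real.exp_le_one_iff.2 (mul_nonpos_of_nonneg_of_nonpos t.2 (by linarith))
      calc _ ≤ ‖vecM (h : Mat n)‖ * 1 := by gcongr
        _ = _ := mul_one _

lemma mem_stabilizer_bpt [NeZero n] {h g : G n} {d : T n} {hd : dn d = 1} :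
    h ∈ MulAction.stabilizer (G n) (bpt g d hd) ↔
      ∀ i j, (d : Fin n → ℝ) i < (d : Fin n → ℝ) j →
        ((g⁻¹ * h * g : G n) : Mat n) i j = 0 := by
  rw [MulAction.mem_stabilizer_iff, smul_bpt, eq_comm, bpt_eq_iff, mul_assoc]

/-! ### Subspaces -/

/-- The image of a subspace of `ℂⁿ` under an element of `SL(n, ℂ)`. -/
def act (g : G n) (W : Submodule ℂ (Fin n → ℂ)) : Submodule ℂ (Fin n → ℂ) :=
  W.map (Matrix.mulVecLin (g : Mat n))

lemma act_mul (g h : G n) (W : Submodule ℂ (Fin n → ℂ)) : act (g * h) W = act g (act h W) := by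
  rw [act, act, act, Matrix.SpecialLinearGroup.coe_mul, Matrix.mulVecLin_mul, Submodule.map_comp]

lemma act_one (W : Submodule ℂ (Fin n → ℂ)) : act 1 W = W := by
  rw [act, Matrix.SpecialLinearGroup.coe_one, Matrix.mulVecLin_one, Submodule.map_id]

lemma act_inv_eq_iff {g : G n} {V W : Submodule ℂ (Fin n → ℂ)} : act g⁻¹ V = W ↔ V = act g W := by
  constructor
  · rintro rfl
    rw [← act_mul, mul_inv_cancel, act_one]
  · rintro rfl
    rw [← act_mul, inv_mul_cancel, act_one]

lemma mulVecLin_injective (g : G n) : Function.Injective (Matrix.mulVecLin (g : Mat n)) := by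
  refine Function.LeftInverse.injective (g := Matrix.mulVecLin ((g⁻¹ : G n) : Mat n)) fun v => ?_
  rw [Matrix.mulVecLin_apply, Matrix.mulVecLin_apply, Matrix.mulVec_mulVec, coe_inv_mul_coe,
    Matrix.one_mulVec]

lemma finrank_act (g : G n) (W : Submodule ℂ (Fin n → ℂ)) :
    Module.finrank ℂ (act g W) = Module.finrank ℂ W :=
  (Submodule.equivMapOfInjective _ (mulVecLin_injective g) W).finrank_eq.symm

lemma act_bot (g : G n) : act g ⊥ = ⊥ := Submodule.map_bot _

lemma act_top (g : G n) : act g ⊤ = ⊤ := by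
  refine (act_inv_eq_iff.1 ?_).symm
  rw [act, Submodule.map_top, LinearMap.range_eq_top]
  exact LinearMap.surjective_of_injective (mulVecLin_injective g⁻¹)

lemma act_eq_of_le {g : G n} {W : Submodule ℂ (Fin n → ℂ)} (h : act g W ≤ W) : act g W = W :=
  Submodule.eq_of_le_of_finrank_eq h (finrank_act g W)

lemma isCompl_act {V W : Submodule ℂ (Fin n → ℂ)} (h : IsCompl V W) (g : G n) :
    IsCompl (act g V) (act g W) := by
  constructor
  · rw [disjoint_iff, act, act, ← Submodule.map_inf _ (mulVecLin_injective g), h.inf_eq_bot,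
      Submodule.map_bot]
  · rw [codisjoint_iff, act, act, ← Submodule.map_sup, h.sup_eq_top]
    exact act_top g

/-- The span of the standard basis vectors with index in `S`. -/
def cs (S : Finset (Fin n)) : Submodule ℂ (Fin n → ℂ) where
  carrier := {v | ∀ i, i ∉ S → v i = 0}
  add_mem' := by
    intro a b ha hb i hi
    simp [ha i hi, hb i hi]
  zero_mem' := by simp
  smul_mem' := by
    intro c a ha i hi
    simp [ha i hi]

lemma mem_cs {S : Finset (Fin n)} {v : Fin n → ℂ} : v ∈ cs S ↔ ∀ i, i ∉ S → v i = 0 := Iff.rfl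

lemma single_mem_cs {S : Finset (Fin n)} {j : Fin n} (hj : j ∈ S) : Pi.single j (1 : ℂ) ∈ cs S := by
  intro i hi
  exact Pi.single_eq_of_ne (by rintro rfl; exact hi hj) _

lemma finrank_cs (S : Finset (Fin n)) : Module.finrank ℂ (cs S) = S.card := by
  have h1 : cs S = ⨅ i ∈ ((Sᶜ : Finset (Fin n)) : Set (Fin n)),
      LinearMap.ker (LinearMap.proj i : (Fin n → ℂ) →ₗ[ℂ] ℂ) := by
    ext v
    simp [mem_cs, Submodule.mem_iInf]
  rw [h1, LinearEquiv.finrank_eq (LinearMap.iInfKerProjEquiv ℂ (fun _ : Fin n => ℂ)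
    (I := (S : Set (Fin n))) (J := ((Sᶜ : Finset (Fin n)) : Set (Fin n)))
    (by simpa using disjoint_compl_right) (by simp))]
  simp

lemma cs_empty : cs (∅ : Finset (Fin n)) = ⊥ := by
  rw [← Submodule.finrank_eq_zero (R := ℂ), finrank_cs, Finset.card_empty]

lemma cs_univ : cs (Finset.univ : Finset (Fin n)) = ⊤ := by
  ext v
  simp [mem_cs]

lemma isCompl_cs (S : Finset (Fin n)) : IsCompl (cs S) (cs Sᶜ) := by
  constructor
  · rw [Submodule.disjoint_def]
    intro v h1 h2
    ext i
    by_cases hi : i ∈ S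
    · exact h2 i (by simpa using hi)
    · exact h1 i hi
  · rw [codisjoint_iff, eq_top_iff]
    intro v _
    rw [Submodule.mem_sup]
    refine ⟨fun i => if i ∈ S then v i else 0, ?_, fun i => if i ∈ S then 0 else v i, ?_, ?_⟩
    · intro i hi
      simp [hi]
    · intro i hi
      simp_all
    · ext i
      by_cases hi : i ∈ S <;> simp [hi]

lemma act_cs_le_iff {g : G n} {S S' : Finset (Fin n)} :
    act g (cs S) ≤ cs S' ↔ ∀ i j, i ∉ S' ∧ j ∈ S → (g : Mat n) i j = 0 := by
  constructor
  · rintro h i j ⟨hi, hj⟩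
    have h1 : Matrix.mulVecLin (g : Mat n) (Pi.single j 1) ∈ cs S' :=
      h (Submodule.mem_map_of_mem (single_mem_cs hj))
    have h2 := h1 i hi
    simpa using h2
  · rintro h _ ⟨v, hv, rfl⟩ i hi
    rw [Matrix.mulVecLin_apply, Matrix.mulVec, dotProduct]
    refine Finset.sum_eq_zero fun j _ => ?_
    by_cases hj : j ∈ S
    · rw [h i j ⟨hi, hj⟩, zero_mul]
    · rw [hv j hj, mul_zero]

lemma act_cs_eq_iff {g : G n} {S : Finset (Fin n)} :
    act g (cs S) = cs S ↔ ∀ i j, i ∉ S ∧ j ∈ S → (g : Mat n) i j = 0 := by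
  rw [← act_cs_le_iff]
  exact ⟨le_of_eq, act_eq_of_le⟩

/-- A transvection, as an element of `SL(n, ℂ)`. -/
def transv {i j : Fin n} (h : i ≠ j) : G n :=
  ⟨Matrix.transvection i j 1, Matrix.det_transvection_of_ne i j h 1⟩

/-- A transvection has a single nonzero off-diagonal entry, so it detects one pair: a group cut out
by vanishing entries determines its vanishing pattern. -/
lemma transv_vanishing_iff {i j : Fin n} (h : i ≠ j) (R : Fin n → Fin n → Prop)
    (hR : ∀ a, ¬ R a a) : (∀ a b, R a b → (transv h : Mat n) a b = 0) ↔ ¬ R i j := by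
  have hv : ∀ a b, a ≠ b → (transv h : Mat n) a b = if i = a ∧ j = b then 1 else 0 := by
    intro a b hab
    change (Matrix.transvection i j (1 : ℂ)) a b = _
    rw [Matrix.transvection, Matrix.add_apply, Matrix.one_apply_ne hab, zero_add,
      Matrix.single_apply]
  constructor
  · intro h1 h2
    have := h1 i j h2
    rw [hv i j h] at this
    simp at this
  · intro h1 a b hab
    have hne : a ≠ b := by rintro rfl; exact hR a hab
    rw [hv a b hne, if_neg]
    rintro ⟨rfl, rfl⟩
    exact h1 hab

/-- A subspace that is invariant under the diagonal matrices is spanned by standard basis vectors. -/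
lemma exists_eq_cs {W : Submodule ℂ (Fin n → ℂ)} (h : ∀ d : T n, act (dexp d) W = W) :
    ∃ S, W = cs S := by
  classical
  have hs : ∀ v ∈ W, ∀ i, v i ≠ 0 → Pi.single i (1 : ℂ) ∈ W := by
    intro v hv i hi
    -- The traceless vector `n e_i - (1, ..., 1)` separates coordinate `i` from the others, so `dexp
    -- x - e⁻¹` projects onto it up to a scalar.
    let x : T n := ⟨fun j => (if j = i then (n : ℝ) else 0) - 1, by
      change ∑ j, ((if j = i then (n : ℝ) else 0) - 1) = 0
      rw [Finset.sum_sub_distrib, Finset.sum_ite_eq' Finset.univ i]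
      simp⟩
    have hx : Matrix.mulVecLin (dexp x : Mat n) v ∈ W := by
      have := Submodule.mem_map_of_mem (f := Matrix.mulVecLin (dexp x : Mat n)) hv
      rw [← h x]
      exact this
    set c : ℂ := (Real.exp ((n : ℝ) - 1) : ℂ) - (Real.exp (0 - 1) : ℂ) with hc
    have hn : n ≠ 0 := by rintro rfl; exact i.elim0
    have hc0 : c ≠ 0 := by
      rw [hc, sub_ne_zero]
      intro e
      apply hn
      have : (n : ℝ) = 0 := by linarith [Real.exp_injective (Complex.ofReal_injective e)]
      exact_mod_cast this
    have h1 : Matrix.mulVecLin (dexp x : Mat n) v - (Real.exp (0 - 1) : ℂ) • v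
        = (c * v i) • Pi.single i (1 : ℂ) := by
      ext j
      rw [Pi.sub_apply, Matrix.mulVecLin_apply, coe_dexp, Matrix.mulVec_diagonal, Pi.smul_apply,
        Pi.smul_apply, smul_eq_mul, smul_eq_mul]
      change ((Real.exp ((if j = i then (n : ℝ) else 0) - 1) : ℝ) : ℂ) * v j - _ = _
      by_cases hj : j = i
      · subst hj
        rw [if_pos rfl, Pi.single_eq_same, hc]
        ring
      · rw [if_neg hj, Pi.single_eq_of_ne hj]
        ring
    have h2 : (c * v i) • Pi.single i (1 : ℂ) ∈ W := by
      rw [← h1]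
      exact W.sub_mem hx (W.smul_mem _ hv)
    exact (W.smul_mem_iff (mul_ne_zero hc0 hi)).1 h2
  refine ⟨Finset.univ.filter fun i => Pi.single i (1 : ℂ) ∈ W, le_antisymm ?_ ?_⟩
  · intro v hv i hi
    by_contra h0
    exact hi (by simpa using hs v hv i h0)
  · intro v hv
    rw [pi_eq_sum_univ' v]
    refine W.sum_mem fun i _ => ?_
    by_cases hi : Pi.single i (1 : ℂ) ∈ W
    · exact W.smul_mem _ hi
    · rw [hv i (by simpa using hi), zero_smul]
      exact W.zero_mem

/-! ### Stabilizers of boundary points and of subspaces -/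

/-- After conjugation by `g`, the stabilizer contains all diagonal matrices, so the subspace is a
coordinate one; transvections then match the two vanishing patterns pair by pair. -/
lemma corresponds_bpt_iff [NeZero n] {W : Submodule ℂ (Fin n → ℂ)} {g : G n} {d : T n}
    {hd : dn d = 1} : Corresponds W (bpt g d hd) ↔ ∃ S : Finset (Fin n), W = act g (cs S) ∧
      ∀ i j, (d : Fin n → ℝ) i < (d : Fin n → ℝ) j ↔ i ∉ S ∧ j ∈ S := by
  have hconj : ∀ (V : Submodule ℂ (Fin n → ℂ)) (h : G n),
      act h (act g V) = act g V ↔ act (g⁻¹ * h * g) V = V := by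
    intro V h
    rw [mul_assoc, act_mul, act_inv_eq_iff, act_mul]
  constructor
  · intro hW
    obtain ⟨W, rfl⟩ : ∃ V, W = act g V := ⟨_, act_inv_eq_iff.1 rfl⟩
    have key : ∀ p : G n, (∀ i j, (d : Fin n → ℝ) i < (d : Fin n → ℝ) j → (p : Mat n) i j = 0) ↔
        act p W = W := by
      intro p
      have h1 := hW (g * p * g⁻¹)
      rw [mem_stabilizer_bpt] at h1
      have h2 : g⁻¹ * (g * p * g⁻¹) * g = p := by group
      rw [h2] at h1
      refine h1.trans ?_
      have h3 := hconj W (g * p * g⁻¹)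
      rw [h2] at h3
      exact h3
    obtain ⟨S, rfl⟩ := exists_eq_cs (W := W) (fun x => (key _).1 fun i j hij => by
      rw [coe_dexp, Matrix.diagonal_apply_ne]
      rintro rfl
      exact lt_irrefl _ hij)
    refine ⟨S, rfl, fun i j => ?_⟩
    rcases eq_or_ne i j with rfl | hij
    · simp
    have h1 := key (transv hij)
    rw [act_cs_eq_iff, transv_vanishing_iff hij
        (fun i j => (d : Fin n → ℝ) i < (d : Fin n → ℝ) j) (fun _ => lt_irrefl _),
      transv_vanishing_iff hij (fun i j => i ∉ S ∧ j ∈ S) (fun _ h => h.1 h.2)] at h1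
    exact not_iff_not.1 h1
  · rintro ⟨S, rfl, hS⟩ h
    rw [mem_stabilizer_bpt]
    refine Iff.trans ?_ (hconj (cs S) h).symm
    rw [act_cs_eq_iff]
    simp only [hS]

/-- A direct sum decomposition of `ℂⁿ` is a translate of a coordinate decomposition. -/
lemma exists_frame_of_isCompl [NeZero n] {W W' : Submodule ℂ (Fin n → ℂ)} (h : IsCompl W W') :
    ∃ (g : G n) (S : Finset (Fin n)), W = act g (cs S) ∧ W' = act g (cs Sᶜ) := by
  classical
  set p := Module.finrank ℂ W with hp
  set q := Module.finrank ℂ W' with hq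
  have hpq : p + q = n := by
    have := Submodule.finrank_add_eq_of_isCompl h
    simpa using this
  set e : Fin p ⊕ Fin q ≃ Fin n := finSumFinEquiv.trans (finCongr hpq) with he
  set B : Module.Basis (Fin n) ℂ (Fin n → ℂ) :=
    (((Module.finBasis ℂ W).prod (Module.finBasis ℂ W')).map
      (Submodule.prodEquivOfIsCompl W W' h)).reindex e with hB
  have hBl : ∀ i, B (e (Sum.inl i)) ∈ W := by
    intro i
    simp [hB]
  have hBr : ∀ i, B (e (Sum.inr i)) ∈ W' := by
    intro i
    simp [hB]
  set f : (Fin n → ℂ) ≃ₗ[ℂ] (Fin n → ℂ) := B.equivFun.symm with hf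
  set A : Mat n := LinearMap.toMatrix' (f : (Fin n → ℂ) →ₗ[ℂ] (Fin n → ℂ)) with hA
  have hdet : A.det ≠ 0 := by
    rw [hA, LinearMap.det_toMatrix']
    exact f.isUnit_det'.ne_zero
  -- Rescaling the adapted basis to determinant one does not move the subspaces.
  obtain ⟨ζ, hζ⟩ := IsAlgClosed.exists_pow_nat_eq A.det⁻¹ (NeZero.pos n)
  let g : G n := ⟨ζ • A, by
    rw [Matrix.det_smul, Fintype.card_fin, hζ, inv_mul_cancel₀ hdet]⟩
  have hg : ∀ v, Matrix.mulVecLin (g : Mat n) v = ζ • ∑ j, v j • B j := by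
    intro v
    change Matrix.mulVecLin (ζ • A) v = _
    rw [Matrix.mulVecLin_apply, Matrix.smul_mulVec, ← Matrix.toLin'_apply, hA,
      Matrix.toLin'_toMatrix', ← B.equivFun_symm_apply]
    rfl
  have hle : ∀ (S : Finset (Fin n)) (V : Submodule ℂ (Fin n → ℂ)), (∀ j ∈ S, B j ∈ V) →
      act g (cs S) ≤ V := by
    rintro S V hS _ ⟨v, hv, rfl⟩
    rw [hg]
    refine V.smul_mem _ (V.sum_mem fun j _ => ?_)
    by_cases hj : j ∈ S
    · exact V.smul_mem _ (hS j hj)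
    · rw [hv j hj, zero_smul]
      exact V.zero_mem
  set S : Finset (Fin n) := Finset.univ.image fun i => e (Sum.inl i) with hS
  have hScard : S.card = p := by
    rw [hS, Finset.card_image_of_injective _ fun i j hij => Sum.inl_injective (e.injective hij)]
    simp
  refine ⟨g, S, ?_, ?_⟩
  · refine (Submodule.eq_of_le_of_finrank_eq (hle S W fun j hj => ?_) ?_).symm
    · obtain ⟨i, _, rfl⟩ := Finset.mem_image.1 hj
      exact hBl i
    · rw [finrank_act, finrank_cs, hScard]
  · refine (Submodule.eq_of_le_of_finrank_eq (hle Sᶜ W' fun j hj => ?_) ?_).symm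
    · obtain ⟨i | i, rfl⟩ := e.surjective j
      · exact absurd (Finset.mem_image_of_mem _ (Finset.mem_univ i)) (Finset.mem_compl.1 hj)
      · exact hBr i
    · rw [finrank_act, finrank_cs, Finset.card_compl, hScard, Fintype.card_fin]
      omega

/-! ### The unique boundary point of a subspace -/

/-- The values of a unit vector of `T` that separates `S` from its complement and is constant on
both. -/
lemma apply_eq_of_separates {d : T n} (hd : dn d = 1) {S : Finset (Fin n)}
    (hS : S.Nonempty) (hS' : Sᶜ.Nonempty)
    (h : ∀ i j, (d : Fin n → ℝ) i < (d : Fin n → ℝ) j ↔ i ∉ S ∧ j ∈ S) (i : Fin n) :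
    (d : Fin n → ℝ) i = (Real.sqrt (4 * n * (S.card * (n - S.card : ℝ) ^ 2
      + (n - S.card) * (S.card : ℝ) ^ 2)))⁻¹ * ((if i ∈ S then (n : ℝ) else 0) - S.card) := by
  obtain ⟨a, ha⟩ := hS
  obtain ⟨b, hb⟩ := hS'
  rw [Finset.mem_compl] at hb
  set m : ℝ := ((S.card : ℕ) : ℝ) with hm
  set α := (d : Fin n → ℝ) a with hα
  set β := (d : Fin n → ℝ) b with hβ
  have hn : (0 : ℝ) < n := by exact_mod_cast a.pos
  have hval : ∀ i, (d : Fin n → ℝ) i = if i ∈ S then α else β := by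
    intro i
    split_ifs with hi
    · exact le_antisymm (not_lt.1 fun hlt => ((h _ _).1 hlt).1 ha)
        (not_lt.1 fun hlt => ((h _ _).1 hlt).1 hi)
    · exact le_antisymm (not_lt.1 fun hlt => hi ((h _ _).1 hlt).2)
        (not_lt.1 fun hlt => hb ((h _ _).1 hlt).2)
  have hsum : ∀ x y : ℝ, ∑ i, (if i ∈ S then x else y) = m * x + (n - m) * y := by
    intro x y
    have hcard : (Sᶜ.card : ℝ) = n - m := by
      rw [Finset.card_compl, Fintype.card_fin, Nat.cast_sub (by simpa using S.card_le_univ)]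
    rw [← Finset.sum_add_sum_compl S, Finset.sum_congr rfl fun i hi => if_pos hi,
      Finset.sum_congr rfl fun i hi => if_neg (Finset.mem_compl.1 hi), Finset.sum_const,
      Finset.sum_const, nsmul_eq_mul, nsmul_eq_mul, hcard]
  have h0 : m * α + (n - m) * β = 0 := by
    rw [← hsum, ← d.2]
    exact Finset.sum_congr rfl fun i _ => (hval i).symm
  have h1 : 4 * n * (m * α ^ 2 + (n - m) * β ^ 2) = 1 := by
    have := dn_sq d
    rw [hd, one_pow] at this
    rw [this, ← hsum]
    congr 1
    refine Finset.sum_congr rfl fun i _ => ?_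
    rw [hval i]
    split_ifs <;> rfl
  have hβα : β < α := (h b a).2 ⟨hb, ha⟩
  set c := (α - β) / n with hc
  have hc0 : 0 < c := div_pos (sub_pos.2 hβα) hn
  -- Trace zero fixes the ratio of the two values and unit norm the positive scale `c`; both depend
  -- only on `n` and the cardinality of `S`.
  have hαc : α = c * (n - m) := by
    rw [hc, div_mul_eq_mul_div, eq_div_iff hn.ne']; linarith
  have hβc : β = c * (0 - m) := by
    rw [hc, div_mul_eq_mul_div, eq_div_iff hn.ne']; linarith
  set Q : ℝ := 4 * n * (m * (n - m) ^ 2 + (n - m) * m ^ 2) with hQ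
  have hcQ : Q * c ^ 2 = 1 := by
    rw [← h1, hαc, hβc, hQ]; ring
  have hQc : Real.sqrt Q = c⁻¹ := by
    have : Q = (c⁻¹) ^ 2 := by
      rw [inv_pow]
      exact eq_inv_of_mul_eq_one_left hcQ
    rw [this, Real.sqrt_sq (inv_nonneg.2 hc0.le)]
  rw [hQc, inv_inv, hval i]
  split_ifs
  · exact hαc
  · exact hβc

lemma exists_separating {S : Finset (Fin n)} (hS : S.Nonempty) (hS' : Sᶜ.Nonempty) :
    ∃ d : T n, dn d = 1 ∧
      ∀ i j, (d : Fin n → ℝ) i < (d : Fin n → ℝ) j ↔ i ∉ S ∧ j ∈ S := by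
  obtain ⟨a, ha⟩ := hS
  obtain ⟨b, hb⟩ := hS'
  rw [Finset.mem_compl] at hb
  have hn : (0 : ℝ) < n := by exact_mod_cast a.pos
  -- This is `n` times the indicator of `S`, made traceless; it is nonzero because it equals
  -- `-S.card` off `S`.
  let x : T n := ⟨fun j => (if j ∈ S then (n : ℝ) else 0) - S.card, by
    change ∑ j, ((if j ∈ S then (n : ℝ) else 0) - S.card) = 0
    rw [Finset.sum_sub_distrib, ← Finset.sum_filter]
    simp [mul_comm]⟩
  have hx : ∀ i, (x : Fin n → ℝ) i = (if i ∈ S then (n : ℝ) else 0) - S.card := fun _ => rfl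
  have hm : (0 : ℝ) < S.card := by exact_mod_cast Finset.card_pos.2 ⟨a, ha⟩
  have hdx : 0 < dn x := by
    refine (dn_nonneg x).lt_of_ne fun h0 => ?_
    have h1 := dn_sq x
    have h2 : (x : Fin n → ℝ) b ^ 2 ≤ ∑ i, (x : Fin n → ℝ) i ^ 2 :=
      Finset.single_le_sum (f := fun i => (x : Fin n → ℝ) i ^ 2) (fun _ _ => sq_nonneg _)
        (Finset.mem_univ b)
    rw [hx b, if_neg hb] at h2
    have h3 : 0 < ∑ i, (x : Fin n → ℝ) i ^ 2 := lt_of_lt_of_le (by nlinarith) h2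
    have h4 : 0 < 4 * n * ∑ i, (x : Fin n → ℝ) i ^ 2 := by positivity
    rw [← h1, ← h0] at h4
    simp at h4
  refine ⟨(dn x)⁻¹ • x, ?_, fun i j => ?_⟩
  · rw [dn_smul, abs_of_pos (inv_pos.2 hdx), inv_mul_cancel₀ hdx.ne']
  · change (dn x)⁻¹ * (x : Fin n → ℝ) i < (dn x)⁻¹ * (x : Fin n → ℝ) j ↔ _
    rw [mul_lt_mul_iff_right₀ (inv_pos.2 hdx), hx, hx, sub_lt_sub_iff_right]
    split_ifs with hi hj hj <;> simp_all

lemma nonempty_of_act_ne {g : G n} {S : Finset (Fin n)} (h : act g (cs S) ≠ ⊥)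
    (h' : act g (cs S) ≠ ⊤) : S.Nonempty ∧ Sᶜ.Nonempty := by
  constructor
  · rw [Finset.nonempty_iff_ne_empty]
    rintro rfl
    exact h (by rw [cs_empty, act_bot])
  · rw [Finset.nonempty_iff_ne_empty]
    intro e
    rw [Finset.compl_eq_empty_iff] at e
    subst e
    exact h' (by rw [cs_univ, act_top])

/-- At most one boundary point corresponds to a nontrivial subspace. -/
lemma Corresponds.unique [NeZero n] {W : Submodule ℂ (Fin n → ℂ)} (hW : W ≠ ⊥ ∧ W ≠ ⊤)
    {z z' : Boundary n} (hz : Corresponds W z) (hz' : Corresponds W z') : z = z' := by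
  obtain ⟨g, d, hd, rfl⟩ := exists_eq_bpt z
  obtain ⟨g', d', hd', rfl⟩ := exists_eq_bpt z'
  obtain ⟨S, rfl, hS⟩ := corresponds_bpt_iff.1 hz
  obtain ⟨S', e, hS'⟩ := corresponds_bpt_iff.1 hz'
  obtain ⟨h1, h2⟩ := nonempty_of_act_ne hW.1 hW.2
  rw [e] at hW
  obtain ⟨h1', h2'⟩ := nonempty_of_act_ne hW.1 hW.2
  have hcard : S.card = S'.card := by
    rw [← finrank_cs S, ← finrank_cs S', ← finrank_act g (cs S), e, finrank_act]
  have hmap : act (g⁻¹ * g') (cs S') ≤ cs S := by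
    rw [act_mul, ← e, ← act_mul, inv_mul_cancel, act_one]
  rw [bpt_eq_iff]
  intro i j hij
  refine act_cs_le_iff.1 hmap i j ?_
  -- Equal cardinalities give both vectors the same scale, so `d i < d' j` happens only for `i ∉ S`,
  -- `j ∈ S'`, where `g⁻¹ g'` vanishes because it maps `cs S'` into `cs S`.
  rw [apply_eq_of_separates hd h1 h2 hS, apply_eq_of_separates hd' h1' h2' hS', ← hcard] at hij
  have hlt := lt_of_mul_lt_mul_left hij (inv_nonneg.2 (Real.sqrt_nonneg _))
  have hn : (0 : ℝ) ≤ n := Nat.cast_nonneg n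
  split_ifs at hlt with hi hj hj
  · exact absurd hlt (lt_irrefl _)
  · linarith
  · exact ⟨hi, hj⟩
  · exact absurd hlt (lt_irrefl _)

lemma existsUnique_corresponds [NeZero n] {W : Submodule ℂ (Fin n → ℂ)} (hW : W ≠ ⊥ ∧ W ≠ ⊤) :
    ∃ z₀ : Boundary n, ∀ z, Corresponds W z ↔ z = z₀ := by
  obtain ⟨W', hW'⟩ := exists_isCompl W
  obtain ⟨g, S, rfl, -⟩ := exists_frame_of_isCompl hW'
  obtain ⟨h1, h2⟩ := nonempty_of_act_ne hW.1 hW.2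
  obtain ⟨d, hd, hS⟩ := exists_separating h1 h2
  have h0 : Corresponds (act g (cs S)) (bpt g d hd) := corresponds_bpt_iff.2 ⟨S, rfl, hS⟩
  exact ⟨bpt g d hd, fun z => ⟨fun hz => hz.unique hW h0, fun hz => hz ▸ h0⟩⟩

/-! ### Joining two boundary points by a geodesic -/

lemma exists_joins_iff [NeZero n] {W W' : Submodule ℂ (Fin n → ℂ)} (hW : W ≠ ⊥ ∧ W ≠ ⊤)
    (hW' : W' ≠ ⊥ ∧ W' ≠ ⊤) {z z' : Boundary n} (hz : Corresponds W z) (hz' : Corresponds W' z') :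
    (∃ γ : GeodesicLine n, γ.Joins z z') ↔ IsCompl W W' := by
  constructor
  · rintro ⟨γ, rfl, rfl⟩
    obtain ⟨g, d, hd, rfl⟩ := exists_eq_lineOf γ
    rw [posRay_lineOf] at hz
    rw [negRay_lineOf] at hz'
    obtain ⟨S, rfl, hS⟩ := corresponds_bpt_iff.1 hz
    obtain ⟨S', rfl, hS'⟩ := corresponds_bpt_iff.1 hz'
    obtain ⟨⟨a, ha⟩, ⟨b, hb⟩⟩ := nonempty_of_act_ne hW.1 hW.2
    rw [Finset.mem_compl] at hb
    have hneg : ∀ i j, (d : Fin n → ℝ) j < (d : Fin n → ℝ) i ↔ i ∉ S' ∧ j ∈ S' := by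
      intro i j
      rw [← hS']
      exact neg_lt_neg_iff.symm
    -- The order pattern of `-d` is that of `d` reversed; comparing with fixed `a ∈ S` and `b ∉ S`
    -- reads off membership in `S'`.
    have : S' = Sᶜ := by
      ext x
      rw [Finset.mem_compl]
      constructor
      · intro hx hxS
        exact ((hneg x b).1 ((hS b x).2 ⟨hb, hxS⟩)).1 hx
      · intro hx
        exact ((hneg a x).1 ((hS x a).2 ⟨hx, ha⟩)).2
    rw [this]
    exact isCompl_act (isCompl_cs S) g
  · intro hc
    obtain ⟨g, S, rfl, rfl⟩ := exists_frame_of_isCompl hc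
    obtain ⟨h1, h2⟩ := nonempty_of_act_ne hW.1 hW.2
    obtain ⟨d, hd, hS⟩ := exists_separating h1 h2
    refine ⟨lineOf g d hd, ?_, ?_⟩
    · rw [posRay_lineOf]
      exact Corresponds.unique hW (corresponds_bpt_iff.2 ⟨S, rfl, hS⟩) hz
    · rw [negRay_lineOf]
      refine Corresponds.unique hW' (corresponds_bpt_iff.2 ⟨Sᶜ, rfl, fun i j => ?_⟩) hz'
      rw [Finset.mem_compl, Finset.mem_compl, not_not, and_comm, ← hS j i]
      exact neg_lt_neg_iff

end SymSpace

theorem lemma4p8 (n : ℕ) (W W' : Submodule ℂ (Fin n → ℂ))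
    (hW : W ≠ ⊥ ∧ W ≠ ⊤) (hW' : W' ≠ ⊥ ∧ W' ≠ ⊤) :
    ∃ zW zW' : SymSpace.Boundary n,
      (∀ z, SymSpace.Corresponds W z ↔ z = zW) ∧
      (∀ z, SymSpace.Corresponds W' z ↔ z = zW') ∧
      ((∃ γ : SymSpace.GeodesicLine n, γ.Joins zW zW') ↔ IsCompl W W') := by
  -- For `n = 0` all subspaces coincide, so a nontrivial `W` rules this case out.
  have : NeZero n := ⟨by
    rintro rfl
    exact hW.1 (Subsingleton.elim _ _)⟩
  obtain ⟨z, hz⟩ := SymSpace.existsUnique_corresponds hW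
  obtain ⟨z', hz'⟩ := SymSpace.existsUnique_corresponds hW'
  exact ⟨z, z', hz, hz', SymSpace.exists_joins_iff hW hW' ((hz z).2 rfl) ((hz' z').2 rfl)⟩
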